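/- Let $P=\{x\in\mathbb R^n:\ \ell_r(x)=\langle x,\nu_r\rangle+\lambda_r\ge 0,\ r=1,\dots,d\}$ be a Delzant polytope, with $\nu_r\in\mathbb Z^n$ the primitive inward normals of its facets and with half-integral offsets $\lambda_r\in\mathbb Z+\tfrac12$. Let $0\le p<n$, and put $$g_P=\tfrac12\sum_r \ell_r\log \ell_r,\qquad H(x)=\tfrac12\sum_{j=1}^p (x^j)^2,\qquad g_s=g_P+sH\quad (s\ge 0).$$ On the open dense orbit $\mathring M=\mathring P\times T^n$ of the associated toric manifold $M$, with action-angle coordinates $(x,\theta)$, symplectic form $\omega=\sum_j dx^j\wedge d\theta^j$ and connection $\nabla \mathbf 1^{U(1)}=-i\,x\cdot d\theta\,\mathbf 1^{U(1)}$, let $$z_s^j=\frac{\partial g_s}{\partial x^j}+i\theta^j,\quad w_s^j=e^{z_s^j},\quad k_s=x\cdot\frac{\partial g_s}{\partial x}-g_s,\quad dZ_s=dz_s^1\wedge\dots\wedge dz_s^n .$$ For $m\in P\cap\mathbb Z^n$ let $\sigma^m_s=w_s^m e^{-k_s}\,\mathbf 1^{U(1)}\otimes\sqrt{dZ_s}$,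 and let $\mathcal H_{\mathcal P_s}$ be the span of the $\sigma^m_s$, $m\in P\cap\mathbb Z^n$, with the norm $$\|\psi\,\mathbf 1^{U(1)}\otimes\sqrt{\alpha}\|^2=\frac1{(2\pi)^n}\int_{M}|\psi|^2\,\|\alpha\|_{K}\,\frac{\omega^n}{n!},\qquad \|\alpha\|_K^2=\frac{\alpha\wedge\bar\alpha}{(2i)^n(-1)^{n(n+1)/2}\,\omega^n/n!}.$$ For a function $f$ let $\hat f^{prQ}=f+i\nabla_{X_f}$, where $\omega(X_f,\cdot)=df$; let $\hat H^{Q}=\frac12\sum_{j=1}^p(\hat x_j^{prQ})^2$, where $\hat x_j^{prQ}$ is $\hat f^{prQ}$ for $f=x^j$; and let $$U_s=\big(e^{s\hat H^{prQ}}\otimes e^{is\mathcal L_{X_H}}\big)\circ e^{-s\hat H^Q},\qquad \tilde\sigma^m_s=U_s(\sigma^m_0).$$ Then $\hat H^Q\sigma^m_s=H(m)\sigma^m_s$ for all $s\ge0$ and $m\in P\cap\mathbb Z^n$; for every $s\ge 0$ the sections $\tilde\sigma^m_s$, $m\in P\cap\mathbb Z^n$, have finite $L^2$ norm and form a basis of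 $\mathcal H_{\mathcal P_s}$; and for every $m\in P\cap\mathbb Z^n$ $$\lim_{s\to\infty}\|\tilde\sigma^m_s\|^2_{L^2}=c_m\,\pi^{p/2},\qquad c_m=\int_P\Big(\prod_{j=1}^p\delta(x^j-m^j)\Big)\,e^{-2((x-m)\cdot y-g_P)}\,(\det D)^{1/2}\,dx^1\cdots dx^n ,$$ where $y=\partial g_P/\partial x$, $D$ is the lower right $(n-p)\times(n-p)$ block of the Hessian of $g_P$, and the integral defining $c_m$ (an integral over the slice $\{x\in P: x^j=m^j,\ j\le p\}$) converges. -/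

import Mathlib

open Filter Topology MeasureTheory

noncomputable section

namespace ToricMixed

/-! ### Delzant polytopes -/

/-- A Delzant polytope in `ℝⁿ` with `d` facets, given by the inequalities
`l_r(x) = ⟨x, ν_r⟩ + λ_r ≥ 0`, where `ν_r` is the primitive inward pointing integral normal to the
`r`-th facet: a compact full-dimensional polytope, every inequality defines a facet, and at every
vertex the normals of the facets through it form a `ℤ`-basis of `ℤⁿ`. -/
structure DelzantPolytope (n d : ℕ) where
  normal : Fin d → Fin n → ℤ
  offset : Fin d → ℝ
  bounded : Bornology.IsBounded
    {x : Fin n → ℝ | ∀ r, 0 ≤ ∑ i, x i * (normal r i : ℝ) + offset r}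
  full_dimensional : ∃ x : Fin n → ℝ, ∀ r, 0 < ∑ i, x i * (normal r i : ℝ) + offset r
  facet : ∀ r, ∃ x : Fin n → ℝ, ∑ i, x i * (normal r i : ℝ) + offset r = 0 ∧
    ∀ r', r' ≠ r → 0 < ∑ i, x i * (normal r' i : ℝ) + offset r'
  primitive : ∀ r, Finset.univ.gcd (normal r) = 1
  vertex : ∀ v ∈ Set.extremePoints ℝ
      {x : Fin n → ℝ | ∀ r, 0 ≤ ∑ i, x i * (normal r i : ℝ) + offset r},
    LinearIndependent ℤ
      (fun r : {r : Fin d // ∑ i, v i * (normal r i : ℝ) + offset r = 0} => normal r.1) ∧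
    Submodule.span ℤ
      (normal '' {r : Fin d | ∑ i, v i * (normal r i : ℝ) + offset r = 0}) = ⊤

/-- The affine function `l_r`. -/
def DelzantPolytope.ell {n d : ℕ} (P : DelzantPolytope n d) (r : Fin d) (x : Fin n → ℝ) : ℝ :=
  ∑ i, x i * (P.normal r i : ℝ) + P.offset r

/-- The polytope as a set. -/
def DelzantPolytope.carrier {n d : ℕ} (P : DelzantPolytope n d) : Set (Fin n → ℝ) :=
  {x | ∀ r, 0 ≤ P.ell r x}

/-- The integral points of the polytope. -/
def DelzantPolytope.latticePoints {n d : ℕ} (P : DelzantPolytope n d) : Set (Fin n → ℤ) :=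
  {m | (fun i => (m i : ℝ)) ∈ P.carrier}

/-- The offsets satisfy `λ_r = λ^L_r + 1/2` with `λ^L_r` an integer. -/
def DelzantPolytope.HalfIntegral {n d : ℕ} (P : DelzantPolytope n d) : Prop :=
  ∀ r, ∃ k : ℤ, P.offset r = (k : ℝ) + 1 / 2

/-! ### Symplectic potentials -/

/-- The partial derivative `∂f/∂x^j`. -/
def partialDeriv {n : ℕ} (f : (Fin n → ℝ) → ℝ) (j : Fin n) (x : Fin n → ℝ) : ℝ :=
  lineDeriv ℝ f x (Pi.single j 1)

/-- The Hessian matrix of `f` at `x`. -/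
def hessian {n : ℕ} (f : (Fin n → ℝ) → ℝ) (x : Fin n → ℝ) : Matrix (Fin n) (Fin n) ℝ :=
  Matrix.of fun j k => partialDeriv (partialDeriv f k) j x

/-- The symplectic potential `g_P = ½ ∑_r l_r log l_r`. -/
def guillemin {n d : ℕ} (P : DelzantPolytope n d) (x : Fin n → ℝ) : ℝ :=
  1 / 2 * ∑ r, P.ell r x * Real.log (P.ell r x)

/-- The Hamiltonian `H = ½ ∑_{j ≤ p} (x^j)²` (coordinates are numbered from `0` in the code). -/
def ham {n : ℕ} (p : ℕ) (x : Fin n → ℝ) : ℝ :=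
  1 / 2 * ∑ j : Fin n, if j.val < p then x j ^ 2 else 0

/-- The symplectic potential `g_s = g_P + s H`. -/
def potential {n d : ℕ} (P : DelzantPolytope n d) (p : ℕ) (s : ℝ) (x : Fin n → ℝ) : ℝ :=
  guillemin P x + s * ham p x

/-- The function `k_s = x · ∂g_s/∂x - g_s`. -/
def kahlerPotential {n d : ℕ} (P : DelzantPolytope n d) (p : ℕ) (s : ℝ) (x : Fin n → ℝ) : ℝ :=
  ∑ j, x j * partialDeriv (potential P p s) j x - potential P p s x

/-! ### The open orbit in action-angle coordinates

The open dense orbit is `P° × Tⁿ` with symplectic form `ω = ∑ dx^j ∧ dθ^j`, where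
`Tⁿ = (ℝ/2πℤ)ⁿ`. Its points are written through lifts `(x, θ) ∈ ℝⁿ × ℝⁿ`; functions and forms on it
are `2π`-periodic in every `θ^j`. Functions and forms given on the open orbit only are extended by
zero to `ℝⁿ × ℝⁿ`. -/

/-- The coordinate space of pairs `(x, θ)`. -/
abbrev Phase (n : ℕ) : Type := (Fin n → ℝ) × (Fin n → ℝ)

/-- The set of `(x, θ)` with `x` in the interior of the polytope. -/
def openOrbit {n d : ℕ} (P : DelzantPolytope n d) : Set (Phase n) :=
  {q | q.1 ∈ interior P.carrier}

/-- A fundamental domain of the open orbit: every `θ^j` lies in `[0, 2π)`. -/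
def fundamentalDomain {n d : ℕ} (P : DelzantPolytope n d) : Set (Phase n) :=
  {q | q.1 ∈ interior P.carrier ∧ ∀ j, q.2 j ∈ Set.Ico 0 (2 * Real.pi)}

/-- The coordinate vector fields `∂/∂x^1, …, ∂/∂x^n, ∂/∂θ^1, …, ∂/∂θ^n`. -/
def frame {n : ℕ} : Fin n ⊕ Fin n → Phase n :=
  Sum.elim (fun j => (Pi.single j 1, 0)) (fun j => (0, Pi.single j 1))

/-- The Hamiltonian vector field `X_f = ∑ (∂f/∂θ^j ∂/∂x^j - ∂f/∂x^j ∂/∂θ^j)`, that is,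
`ω(X_f, ·) = df`. -/
def hamVF {n : ℕ} (f : Phase n → ℝ) (q : Phase n) : Phase n :=
  (fun j => lineDeriv ℝ f q (frame (Sum.inr j)), fun j => -lineDeriv ℝ f q (frame (Sum.inl j)))

/-- The connection form `-i x · dθ` of the trivializing section `1^{U(1)}`. -/
def connForm {n : ℕ} (q v : Phase n) : ℂ :=
  -Complex.I * ∑ j, ((q.1 j * v.2 j : ℝ) : ℂ)

/-- The Kostant-Souriau operator `f + i ∇_{X_f}`, acting on the coefficient `ψ` of the section
`ψ 1^{U(1)}`. -/
def prequantum {n : ℕ} (f : Phase n → ℝ) (ψ : Phase n → ℂ) (q : Phase n) : ℂ :=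
  (f q : ℂ) * ψ q +
    Complex.I * (lineDeriv ℝ ψ q (hamVF f q) + connForm q (hamVF f q) * ψ q)

/-- The quantum operator `H^Q = ½ ∑_{j ≤ p} (x̂_j)²`, with `x̂_j` the Kostant-Souriau operator of
the coordinate function `x^j`. -/
def quantumHam {n : ℕ} (p : ℕ) (ψ : Phase n → ℂ) (q : Phase n) : ℂ :=
  1 / 2 * ∑ j : Fin n, if j.val < p then
    prequantum (fun q' => q'.1 j) (prequantum (fun q' => q'.1 j) ψ) q else 0

/-- The Lie derivative of a complex 1-form along a vector field on `ℝⁿ × ℝⁿ`: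
`(L_X η)(v) = X(η(v)) + η(D_v X)` for constant vector fields `v`. -/
def lieDeriv {n : ℕ} (X : Phase n → Phase n) (η : Phase n → (Phase n →L[ℝ] ℂ)) (q : Phase n) :
    Phase n →L[ℝ] ℂ :=
  lineDeriv ℝ η q (X q) + (η q).comp (fderiv ℝ X q)

/-- The exponential `e^{cA} f = ∑_k c^k/k! A^k f` of an operator, as a pointwise power series. -/
def opExp {n : ℕ} {V : Type*} [AddCommMonoid V] [Module ℂ V] [TopologicalSpace V]
    (A : (Phase n → V) → (Phase n → V)) (c : ℂ) (f : Phase n → V) (q : Phase n) : V :=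
  ∑' k : ℕ, (c ^ k / (k.factorial : ℂ)) • (A^[k] f) q

/-! ### Half-form corrected sections -/

/-- A half-form corrected section `ψ 1^{U(1)} ⊗ √(η_1 ∧ ⋯ ∧ η_n)` over the open orbit. -/
structure HalfFormSection (n : ℕ) where
  coeff : Phase n → ℂ
  form : Fin n → Phase n → (Phase n →L[ℝ] ℂ)

/-- The `n`-form norm `‖α‖_K` at `q`, `‖α‖_K² = α ∧ ᾱ / ((2i)ⁿ (-1)^{n(n+1)/2} ωⁿ/n!)`, for
`α = η_1 ∧ ⋯ ∧ η_n`. Both `2n`-forms are evaluated on `∂/∂x^1, …, ∂/∂x^n, ∂/∂θ^1, …, ∂/∂θ^n`, where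
`ωⁿ/n!` takes the value `(-1)^{n(n-1)/2}`. -/
def canonicalNorm {n : ℕ} (η : Fin n → Phase n → (Phase n →L[ℝ] ℂ)) (q : Phase n) : ℝ :=
  Real.sqrt
    ((Matrix.det (Matrix.of fun a b : Fin n ⊕ Fin n =>
        Sum.elim (fun j => η j q (frame b)) (fun j => (starRingEnd ℂ) (η j q (frame b))) a)) /
      ((2 * Complex.I) ^ n * (-1) ^ (n * (n + 1) / 2) * (-1) ^ (n * (n - 1) / 2))).re

/-- The pointwise squared norm `|ψ|² ‖η_1 ∧ ⋯ ∧ η_n‖_K`. -/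
def pointNormSq {n : ℕ} (σ : HalfFormSection n) (q : Phase n) : ℝ :=
  ‖σ.coeff q‖ ^ 2 * canonicalNorm σ.form q

/-- The squared `L²` norm `(2π)^{-n} ∫ |ψ|² ‖η_1 ∧ ⋯ ∧ η_n‖_K ωⁿ/n!`; the Liouville measure is
`dx dθ`, and the complement of the open orbit is a null set. -/
def normSq {n d : ℕ} (P : DelzantPolytope n d) (σ : HalfFormSection n) : ℝ :=
  1 / (2 * Real.pi) ^ n * ∫ q in fundamentalDomain P, pointNormSq σ q

/-- The (multivalued) holomorphic coordinate `z_s^j = ∂g_s/∂x^j + i θ^j`. -/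
def zCoord {n d : ℕ} (P : DelzantPolytope n d) (p : ℕ) (s : ℝ) (j : Fin n) (q : Phase n) : ℂ :=
  (partialDeriv (potential P p s) j q.1 : ℂ) + Complex.I * (q.2 j : ℂ)

/-- The 1-forms `dz_s^1, …, dz_s^n`, standing for `dZ_s = dz_s^1 ∧ ⋯ ∧ dz_s^n`. -/
def dZ {n d : ℕ} (P : DelzantPolytope n d) (p : ℕ) (s : ℝ) (j : Fin n) :
    Phase n → (Phase n →L[ℝ] ℂ) :=
  (openOrbit P).indicator fun q => fderiv ℝ (zCoord P p s j) q

/-- The monomial section `σ^m_s = w_s^m e^{-k_s} 1^{U(1)} ⊗ √dZ_s`, with `w_s^j = e^{z_s^j}`. -/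
def monomialSection {n d : ℕ} (P : DelzantPolytope n d) (p : ℕ) (s : ℝ) (m : Fin n → ℤ) :
    HalfFormSection n where
  coeff := (openOrbit P).indicator fun q =>
    (∏ j, Complex.exp (zCoord P p s j q) ^ (m j)) * Complex.exp (-(kahlerPotential P p s q.1 : ℂ))
  form := dZ P p s

/-- The half-form corrected quantum space of the Kähler polarization with symplectic potential
`g_s`: all `ψ 1^{U(1)} ⊗ √dZ_s` with `ψ` in the span of the coefficients of the `σ^m_s`, for `m`
an integral point of the polytope. It is given as the space of these coefficients `ψ`. -/
def quantumSpace {n d : ℕ} (P : DelzantPolytope n d) (p : ℕ) (s : ℝ) :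
    Submodule ℂ (Phase n → ℂ) :=
  Submodule.span ℂ (Set.range fun m : P.latticePoints => (monomialSection P p s m.1).coeff)

/-- The generalized coherent state transform
`U_s = (e^{s Ĥ^{prQ}} ⊗ e^{i s L_{X_H}}) ∘ e^{-s Ĥ^Q}`. The automorphism `e^{i s L_{X_H}}` of the
exterior algebra acts on `√(η_1 ∧ ⋯ ∧ η_n)` through the factors `η_j`. -/
def gcst {n : ℕ} (p : ℕ) (s : ℝ) (σ : HalfFormSection n) : HalfFormSection n where
  coeff := opExp (prequantum fun q => ham p q.1) (s : ℂ)
    (opExp (quantumHam p) (-(s : ℂ)) σ.coeff)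
  form := fun j => opExp (lieDeriv (hamVF fun q => ham p q.1)) (Complex.I * (s : ℂ)) (σ.form j)

/-! ### The limit constant -/

/-- The measure `∏_{j ≤ p} δ(x^j - m^j) dx^1 ⋯ dx^n`: Dirac measures in the first `p` coordinates
and Lebesgue measure in the others. -/
def deltaMeasure {n : ℕ} (p : ℕ) (m : Fin n → ℤ) : Measure (Fin n → ℝ) :=
  Measure.pi fun j : Fin n => if j.val < p then Measure.dirac (m j : ℝ) else volume

/-- The lower right `(n-p) × (n-p)` block `D` of the Hessian of `g_P`. -/
def lowerBlock {n d : ℕ} (P : DelzantPolytope n d) (p : ℕ) (x : Fin n → ℝ) :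
    Matrix {j : Fin n // p ≤ j.val} {j : Fin n // p ≤ j.val} ℝ :=
  (hessian (guillemin P) x).submatrix Subtype.val Subtype.val

/-- The function `e^{-2((x-m)·y - g_P)} (det D)^{1/2}`, with `y = ∂g_P/∂x`. -/
def limitDensity {n d : ℕ} (P : DelzantPolytope n d) (p : ℕ) (m : Fin n → ℤ)
    (x : Fin n → ℝ) : ℝ :=
  Real.exp (-2 * (∑ j, (x j - m j) * partialDeriv (guillemin P) j x - guillemin P x)) *
    Real.sqrt (lowerBlock P p x).det

/-- The constant `c_m`. -/
def limitConst {n d : ℕ} (P : DelzantPolytope n d) (p : ℕ) (m : Fin n → ℤ) : ℝ :=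
  ∫ x in P.carrier, limitDensity P p m x ∂(deltaMeasure p m)

end ToricMixed

end

noncomputable section

namespace ToricMixed

/-! ### The interior of the polytope -/

section Polytope

variable {n d : ℕ} (P : DelzantPolytope n d)

/-! The coefficient of `σ^m_s` transforms under the torus by the character of weight `m`, and on
functions of weight `m` every operator involved is multiplication by a function of `x`: `x̂_j` acts
by `m^j`, `H^Q` by `H(m)`, and `Ĥ^{prQ}` by `∑_{j≤p} x^j m^j - H(x)`. Passing from `g_P` to `g_s`
adds `s x^j` to the gradient for `j ≤ p`, so the exponential of the last operator carries the
coefficient of `σ^m_0` exactly to that of `σ^m_s`. On half-forms `L_{X_H}` squares to zero on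
`dz_0^j`, and the two surviving terms give `dz_s^j`. Hence `U_s σ^m_0 = e^{-sH(m)} σ^m_s`
(`gcst_monomialSection_coeff`, `gcst_monomialSection_form`). The basis claim follows because
sections of different weights restrict on a torus fibre to multiples of different characters.

For the norms, completing the square turns the density on `P` into `e^{-s ∑_{j≤p} (x^j-m^j)²}
e^{-2((x-m)·y-g_P)} (det Hess g_s)^{1/2}`. The middle factor is `∏_r l_r(x)^{l_r(m)}
e^{l_r(m)-l_r(x)}`, while the determinant blows up at the boundary. A Schur complement shows that
`∏_r l_r · det Hess g_s` is a polynomial in `x` and `s` (`det_extMatrix`), and half-integrality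
gives `l_r(m) ≥ 1/2`, so one factor `l_r^{1/2}` can be spared for each facet. The density is
therefore continuous up to the boundary and the norms are finite.

Substituting `x^j = m^j + ε u^j` for `j ≤ p`, with `ε = s^{-1/2}`, produces a Jacobian `ε^p` that
cancels the factor `s^{p/2}` coming out of the root of the determinant. What remains is a fixed
Gaussian times a function continuous in `ε` up to `ε = 0`, cut off by the indicator of the polytope.
At `ε = 0` the determinant reduces to that of `D`. Dominated convergence and Fubini yield `π^{p/2}
c_m`; the jump of the indicator is harmless because `l_r(m) ≠ 0` makes the slice meet each facet
hyperplane in a null set. -/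

theorem DelzantPolytope.continuous_ell (r : Fin d) : Continuous (P.ell r) := by
  unfold DelzantPolytope.ell
  fun_prop

theorem DelzantPolytope.ell_add_smul (r : Fin d) (x v : Fin n → ℝ) (t : ℝ) :
    P.ell r (x + t • v) = P.ell r x + t * ∑ i, v i * (P.normal r i : ℝ) := by
  simp only [DelzantPolytope.ell, Pi.add_apply, Pi.smul_apply, smul_eq_mul, add_mul,
    Finset.sum_add_distrib, Finset.mul_sum, mul_assoc]
  ring

theorem DelzantPolytope.isClosed_carrier : IsClosed P.carrier := by
  simp only [DelzantPolytope.carrier, Set.ofPred_forall]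
  exact isClosed_iInter fun r => isClosed_le continuous_const (P.continuous_ell r)

theorem DelzantPolytope.isCompact_carrier : IsCompact P.carrier :=
  Metric.isCompact_of_isClosed_isBounded P.isClosed_carrier P.bounded

theorem DelzantPolytope.exists_normal_ne_zero (r : Fin d) : ∃ i, P.normal r i ≠ 0 := by
  by_contra! h
  have := P.primitive r
  rw [Finset.gcd_eq_zero_iff.2 fun i _ => h i] at this
  exact zero_ne_one this

/-- A primitive normal is nonzero, so a small move from an interior point against `ν_r` stays in the
polytope and strictly lowers `l_r`; hence `l_r` was positive. -/
theorem DelzantPolytope.interior_carrier :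
    interior P.carrier = {x | ∀ r, 0 < P.ell r x} := by
  apply Set.Subset.antisymm
  · intro x hx r
    obtain ⟨i, hi⟩ := P.exists_normal_ne_zero r
    have hc : ContinuousAt
        (fun t : ℝ => x + t • (fun i => -(P.normal r i : ℝ))) 0 := by fun_prop
    have hev : ∀ᶠ t : ℝ in 𝓝 0,
        x + t • (fun i => -(P.normal r i : ℝ)) ∈ interior P.carrier :=
      hc.eventually_mem (isOpen_interior.mem_nhds (by simpa using hx))
    obtain ⟨t, ht, ht0⟩ := ((hev.filter_mono nhdsWithin_le_nhds).and
      (self_mem_nhdsWithin : Set.Ioi (0 : ℝ) ∈ 𝓝[>] 0)).exists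
    have h1 : 0 ≤ P.ell r _ := interior_subset ht r
    rw [P.ell_add_smul] at h1
    have h2 : 0 < ∑ i, (P.normal r i : ℝ) * (P.normal r i : ℝ) :=
      Finset.sum_pos' (fun i _ => mul_self_nonneg _)
        ⟨i, Finset.mem_univ i, mul_self_pos.2 (by exact_mod_cast hi)⟩
    simp only [neg_mul, Finset.sum_neg_distrib, mul_neg] at h1
    have h3 := mul_pos (show (0 : ℝ) < t from ht0) h2
    linarith
  · apply interior_maximal (fun x hx r => (hx r).le)
    simp only [Set.ofPred_forall]
    exact isOpen_iInter_of_finite fun r => isOpen_lt continuous_const (P.continuous_ell r)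

theorem DelzantPolytope.mem_interior_carrier {x : Fin n → ℝ} :
    x ∈ interior P.carrier ↔ ∀ r, 0 < P.ell r x := by
  rw [P.interior_carrier]; rfl

theorem DelzantPolytope.interior_carrier_nonempty : (interior P.carrier).Nonempty := by
  obtain ⟨x, hx⟩ := P.full_dimensional
  exact ⟨x, P.mem_interior_carrier.2 hx⟩

/-- At a lattice point `l_r` is an integer plus `1/2`, so nonnegativity already forces the integer
to be nonnegative. This keeps lattice points off the boundary and makes the exponents `l_r(m) - 1/2`
nonnegative. -/
theorem DelzantPolytope.HalfIntegral.half_le_ell {P : DelzantPolytope n d} (hP : P.HalfIntegral)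
    {m : Fin n → ℤ} (hm : m ∈ P.latticePoints) (r : Fin d) :
    1 / 2 ≤ P.ell r (fun i => (m i : ℝ)) := by
  obtain ⟨k, hk⟩ := hP r
  have h0 : 0 ≤ P.ell r (fun i => (m i : ℝ)) := hm r
  have h1 : P.ell r (fun i => (m i : ℝ)) = ((∑ i, m i * P.normal r i + k : ℤ) : ℝ) + 1 / 2 := by
    rw [DelzantPolytope.ell, hk]; push_cast; ring
  rw [h1] at h0 ⊢
  have h2 : (-1 : ℝ) < ((∑ i, m i * P.normal r i + k : ℤ) : ℝ) := by linarith
  have h3 : -1 < ∑ i, m i * P.normal r i + k := by exact_mod_cast h2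
  have h4 : (0 : ℝ) ≤ ((∑ i, m i * P.normal r i + k : ℤ) : ℝ) := by
    exact_mod_cast (by omega : 0 ≤ ∑ i, m i * P.normal r i + k)
  linarith

end Polytope

/-! ### Derivatives of the symplectic potentials -/

section Potential

variable {n d : ℕ} (P : DelzantPolytope n d) (p : ℕ) (s : ℝ)

/-- The explicit gradient of the symplectic potential `g_s`. -/
def gradPotential (j : Fin n) (x : Fin n → ℝ) : ℝ :=
  1 / 2 * ∑ r, (P.normal r j : ℝ) * (Real.log (P.ell r x) + 1) +
    s * if j.val < p then x j else 0

/-- The explicit Hessian of the symplectic potential `g_s`. -/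
def hessPotential (x : Fin n → ℝ) : Matrix (Fin n) (Fin n) ℝ :=
  Matrix.of fun j k =>
    1 / 2 * ∑ r, (P.normal r j : ℝ) * (P.normal r k : ℝ) / P.ell r x +
      s * if j = k ∧ j.val < p then 1 else 0

theorem hasFDerivAt_ell (r : Fin d) (x : Fin n → ℝ) :
    HasFDerivAt (P.ell r)
      (∑ i, (P.normal r i : ℝ) • ContinuousLinearMap.proj (R := ℝ) (φ := fun _ : Fin n => ℝ) i)
      x := by
  unfold DelzantPolytope.ell
  refine HasFDerivAt.add_const _ (HasFDerivAt.fun_sum fun i _ => ?_)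
  exact (hasFDerivAt_apply i x).mul_const _

theorem hasFDerivAt_coord (j : Fin n) (x : Fin n → ℝ) :
    HasFDerivAt (fun x : Fin n → ℝ => if j.val < p then x j else 0)
      (if j.val < p then
        ContinuousLinearMap.proj (R := ℝ) (φ := fun _ : Fin n => ℝ) j else 0) x := by
  split_ifs
  · exact hasFDerivAt_apply j x
  · exact hasFDerivAt_const _ _

theorem hasFDerivAt_ham (x : Fin n → ℝ) :
    HasFDerivAt (ham (n := n) p)
      (∑ j : Fin n, (if j.val < p then x j else 0) •
        ContinuousLinearMap.proj (R := ℝ) (φ := fun _ : Fin n => ℝ) j) x := by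
  have h : ∀ j : Fin n, HasFDerivAt (fun x : Fin n → ℝ => if j.val < p then x j ^ 2 else 0)
      ((2 : ℝ) • (if j.val < p then x j else 0) •
        ContinuousLinearMap.proj (R := ℝ) (φ := fun _ : Fin n => ℝ) j) x := by
    intro j
    split_ifs
    · have := (hasFDerivAt_apply (𝕜 := ℝ) j x).pow 2
      refine this.congr_fderiv ?_
      ext v
      simp [mul_assoc]
    · simpa using hasFDerivAt_const (𝕜 := ℝ) (0 : ℝ) x
  have := (HasFDerivAt.fun_sum (u := Finset.univ) fun j _ => h j).const_mul (1 / 2 : ℝ)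
  refine this.congr_fderiv ?_
  rw [← Finset.smul_sum, smul_smul]
  norm_num

variable {P} {x : Fin n → ℝ}

theorem hasFDerivAt_guillemin (hx : x ∈ interior P.carrier) :
    HasFDerivAt (guillemin P)
      (∑ j, gradPotential P p 0 j x •
        ContinuousLinearMap.proj (R := ℝ) (φ := fun _ : Fin n => ℝ) j) x := by
  have h : ∀ r, HasFDerivAt (fun x => P.ell r x * Real.log (P.ell r x)) _ x := fun r =>
    (Real.hasDerivAt_mul_log (P.mem_interior_carrier.1 hx r).ne').comp_hasFDerivAt x
      (hasFDerivAt_ell P r x)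
  have := (HasFDerivAt.fun_sum (u := Finset.univ) fun r _ => h r).const_mul (1 / 2 : ℝ)
  refine this.congr_fderiv ?_
  ext v
  simp only [gradPotential, smul_apply, sum_apply,
    ContinuousLinearMap.proj_apply, smul_eq_mul, Finset.mul_sum, Finset.sum_mul, zero_mul, add_zero]
  rw [Finset.sum_comm]
  refine Finset.sum_congr rfl fun _ _ => Finset.sum_congr rfl fun _ _ => by ring

theorem hasFDerivAt_potential (hx : x ∈ interior P.carrier) :
    HasFDerivAt (potential P p s)
      (∑ j, gradPotential P p s j x •
        ContinuousLinearMap.proj (R := ℝ) (φ := fun _ : Fin n => ℝ) j) x := by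
  refine ((hasFDerivAt_guillemin p hx).add ((hasFDerivAt_ham p x).const_mul s)).congr_fderiv ?_
  rw [Finset.smul_sum, ← Finset.sum_add_distrib]
  refine Finset.sum_congr rfl fun j _ => ?_
  rw [smul_smul, ← add_smul]
  simp only [gradPotential, zero_mul, add_zero]

theorem partialDeriv_eq_of_hasFDerivAt {f : (Fin n → ℝ) → ℝ} {a : Fin n → ℝ} {x : Fin n → ℝ}
    (h : HasFDerivAt f
      (∑ j, a j • ContinuousLinearMap.proj (R := ℝ) (φ := fun _ : Fin n => ℝ) j) x) (j : Fin n) :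
    partialDeriv f j x = a j := by
  rw [partialDeriv, (h.hasLineDerivAt _).lineDeriv]
  simp [Pi.single_apply]

theorem partialDeriv_potential (hx : x ∈ interior P.carrier) (j : Fin n) :
    partialDeriv (potential P p s) j x = gradPotential P p s j x :=
  partialDeriv_eq_of_hasFDerivAt (hasFDerivAt_potential p s hx) j

theorem partialDeriv_guillemin (hx : x ∈ interior P.carrier) (j : Fin n) :
    partialDeriv (guillemin P) j x = gradPotential P p 0 j x :=
  partialDeriv_eq_of_hasFDerivAt (hasFDerivAt_guillemin p hx) j

theorem hasFDerivAt_gradPotential (hx : x ∈ interior P.carrier) (j : Fin n) :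
    HasFDerivAt (gradPotential P p s j)
      (∑ k, hessPotential P p s x j k •
        ContinuousLinearMap.proj (R := ℝ) (φ := fun _ : Fin n => ℝ) k) x := by
  have h : ∀ r, HasFDerivAt (fun x => (P.normal r j : ℝ) * (Real.log (P.ell r x) + 1)) _ x :=
    fun r => (((hasFDerivAt_ell P r x).log (P.mem_interior_carrier.1 hx r).ne').add_const
      (1 : ℝ)).const_mul (P.normal r j : ℝ)
  have := ((HasFDerivAt.fun_sum (u := Finset.univ) fun r _ => h r).const_mul (1 / 2 : ℝ)).add
    ((hasFDerivAt_coord p j x).const_mul s)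
  refine this.congr_fderiv ?_
  ext v
  simp only [hessPotential, Matrix.of_apply, add_apply,
    smul_apply, sum_apply,
    ContinuousLinearMap.proj_apply, smul_eq_mul, Finset.mul_sum, Finset.sum_mul, add_mul,
    Finset.sum_add_distrib]
  congr 1
  · rw [Finset.sum_comm]
    refine Finset.sum_congr rfl fun _ _ => Finset.sum_congr rfl fun _ _ => by ring
  · by_cases h : j.val < p <;> simp [h]

theorem hessian_guillemin (hx : x ∈ interior P.carrier) (j k : Fin n) :
    hessian (guillemin P) x j k = hessPotential P p 0 x k j := by
  have h : partialDeriv (guillemin P) k =ᶠ[𝓝 x] gradPotential P p 0 k :=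
    (isOpen_interior.mem_nhds hx : _ ∈ 𝓝 x) |> fun hm =>
      Filter.mem_of_superset hm fun y hy => partialDeriv_guillemin p hy k
  rw [hessian, Matrix.of_apply, partialDeriv, h.lineDeriv_eq]
  exact partialDeriv_eq_of_hasFDerivAt (hasFDerivAt_gradPotential p 0 hx k) j

theorem isOpen_openOrbit : IsOpen (openOrbit P) :=
  isOpen_interior.preimage continuous_fst

theorem hasFDerivAt_zCoord {q : Phase n} (hq : q ∈ openOrbit P) (j : Fin n) :
    HasFDerivAt (zCoord P p s j)
      (Complex.ofRealCLM.comp ((∑ k, hessPotential P p s q.1 j k •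
          ContinuousLinearMap.proj (R := ℝ) (φ := fun _ : Fin n => ℝ) k).comp
            (ContinuousLinearMap.fst ℝ (Fin n → ℝ) (Fin n → ℝ))) +
        Complex.I • Complex.ofRealCLM.comp
          ((ContinuousLinearMap.proj (R := ℝ) (φ := fun _ : Fin n => ℝ) j).comp
            (ContinuousLinearMap.snd ℝ (Fin n → ℝ) (Fin n → ℝ)))) q := by
  have h1 : HasFDerivAt (fun q' : Phase n => (gradPotential P p s j q'.1 : ℂ)) _ q :=
    Complex.ofRealCLM.hasFDerivAt.comp q
      ((hasFDerivAt_gradPotential p s (hq : q.1 ∈ _) j).comp q hasFDerivAt_fst)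
  have h2 : HasFDerivAt (fun q' : Phase n => Complex.I * (q'.2 j : ℂ)) _ q :=
    (Complex.I • Complex.ofRealCLM.comp
          ((ContinuousLinearMap.proj (R := ℝ) (φ := fun _ : Fin n => ℝ) j).comp
            (ContinuousLinearMap.snd ℝ (Fin n → ℝ) (Fin n → ℝ)))).hasFDerivAt
  refine (h1.add h2).congr_of_eventuallyEq ?_
  filter_upwards [isOpen_openOrbit.mem_nhds hq] with q' hq'
  simp only [zCoord, partialDeriv_potential p s hq', Pi.add_apply]

theorem dZ_frame_inl {q : Phase n} (hq : q ∈ openOrbit P) (j k : Fin n) :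
    dZ P p s j q (frame (Sum.inl k)) = (hessPotential P p s q.1 j k : ℂ) := by
  rw [dZ, Set.indicator_of_mem hq, (hasFDerivAt_zCoord p s hq j).fderiv]
  simp [frame, Pi.single_apply]

theorem dZ_frame_inr {q : Phase n} (hq : q ∈ openOrbit P) (j k : Fin n) :
    dZ P p s j q (frame (Sum.inr k)) = if j = k then Complex.I else 0 := by
  rw [dZ, Set.indicator_of_mem hq, (hasFDerivAt_zCoord p s hq j).fderiv]
  by_cases h : j = k <;> simp [frame, h]

end Potential

/-! ### The quantum operators on functions of a given weight -/

section Weight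

variable {n : ℕ}

/-- A function on phase space which transforms under translations of the angles by the character
of weight `m`. -/
def HasWeight (m : Fin n → ℤ) (ψ : Phase n → ℂ) : Prop :=
  ∀ x θ τ : Fin n → ℝ,
    ψ (x, θ + τ) = Complex.exp (Complex.I * ((∑ j, (m j : ℝ) * τ j : ℝ) : ℂ)) * ψ (x, θ)

variable {m : Fin n → ℤ} {ψ : Phase n → ℂ}

theorem HasWeight.mul_fst (h : HasWeight m ψ) (c : (Fin n → ℝ) → ℂ) :
    HasWeight m fun q => c q.1 * ψ q := by
  intro x θ τ
  simp only [h x θ τ]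
  ring

/-- Along an angle direction `ψ` is a constant times an exponential, so no smoothness of `ψ` in `x`
is needed. -/
theorem HasWeight.lineDeriv_eq (h : HasWeight m ψ) (q : Phase n) (v : Fin n → ℝ) :
    lineDeriv ℝ ψ q (0, v) = Complex.I * ((∑ j, (m j : ℝ) * v j : ℝ) : ℂ) * ψ q := by
  have h1 : (fun t : ℝ => ψ (q + t • ((0, v) : Phase n))) = fun t : ℝ =>
      Complex.exp ((t : ℂ) * (Complex.I * ((∑ j, (m j : ℝ) * v j : ℝ) : ℂ))) * ψ q := by
    funext t
    have : q + t • ((0, v) : Phase n) = (q.1, q.2 + t • v) := by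
      ext <;> simp
    rw [this, h q.1 q.2 (t • v)]
    congr 2
    push_cast
    simp only [Pi.smul_apply, smul_eq_mul, Finset.mul_sum]
    refine Finset.sum_congr rfl fun _ _ => by push_cast; ring
  rw [lineDeriv, h1]
  have h2 := (((Complex.ofRealCLM.hasDerivAt (x := (0 : ℝ))).mul_const
    (Complex.I * ((∑ j, (m j : ℝ) * v j : ℝ) : ℂ))).cexp).mul_const (ψ q)
  simpa using h2.deriv

theorem hamVF_comp_fst {f : (Fin n → ℝ) → ℝ} {a : Fin n → ℝ} {q : Phase n}
    (h : HasFDerivAt f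
      (∑ j, a j • ContinuousLinearMap.proj (R := ℝ) (φ := fun _ : Fin n => ℝ) j) q.1) :
    hamVF (fun q => f q.1) q = (0, fun j => -a j) := by
  have h1 : HasFDerivAt (fun q : Phase n => f q.1) _ q := h.comp q hasFDerivAt_fst
  ext j
  · simp only [hamVF, (h1.hasLineDerivAt _).lineDeriv]
    simp [frame]
  · simp only [hamVF, (h1.hasLineDerivAt _).lineDeriv]
    simp [frame, Pi.single_apply]

/-- When `f` depends on `x` only, `X_f` points along the angles, where both the derivative and the
connection act by scalars. -/
theorem HasWeight.prequantum_comp_fst (hψ : HasWeight m ψ) {f : (Fin n → ℝ) → ℝ} {a : Fin n → ℝ}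
    {q : Phase n}
    (h : HasFDerivAt f
      (∑ j, a j • ContinuousLinearMap.proj (R := ℝ) (φ := fun _ : Fin n => ℝ) j) q.1) :
    prequantum (fun q => f q.1) ψ q =
      ((f q.1 + ∑ j, a j * (m j - q.1 j) : ℝ) : ℂ) * ψ q := by
  rw [prequantum, hamVF_comp_fst h, hψ.lineDeriv_eq, connForm]
  have h1 : (∑ j, a j * ((m j : ℝ) - q.1 j)) = ∑ j, q.1 j * -a j - ∑ j, (m j : ℝ) * -a j := by
    rw [← Finset.sum_sub_distrib]
    exact Finset.sum_congr rfl fun _ _ => by ring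
  rw [h1]
  push_cast
  linear_combination (-(∑ j, (q.1 j : ℂ) * -(a j : ℂ)) + ∑ j, (m j : ℂ) * -(a j : ℂ)) * ψ q *
    Complex.I_mul_I

theorem HasWeight.prequantum_coord (hψ : HasWeight m ψ) (j : Fin n) :
    prequantum (fun q => q.1 j) ψ = fun q => (m j : ℂ) * ψ q := by
  funext q
  have h := hψ.prequantum_comp_fst (f := fun x => x j) (a := Pi.single j 1) (q := q) (by
    refine (hasFDerivAt_apply j q.1).congr_fderiv ?_
    ext v
    simp [Pi.single_apply])
  rw [h]
  simp [Pi.single_apply]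

theorem HasWeight.quantumHam_eq (hψ : HasWeight m ψ) (p : ℕ) :
    quantumHam p ψ = fun q => ((ham p (fun i => (m i : ℝ)) : ℝ) : ℂ) * ψ q := by
  funext q
  have h : ∀ j, prequantum (fun q' => q'.1 j) (prequantum (fun q' => q'.1 j) ψ) q =
      (m j : ℂ) ^ 2 * ψ q := by
    intro j
    rw [hψ.prequantum_coord, (hψ.mul_fst fun _ => (m j : ℂ)).prequantum_coord]
    ring
  simp only [quantumHam, h, ham]
  push_cast
  rw [mul_assoc, Finset.sum_mul]
  congr 1
  refine Finset.sum_congr rfl fun j _ => ?_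
  split_ifs <;> simp

theorem HasWeight.prequantum_ham (hψ : HasWeight m ψ) (p : ℕ) :
    prequantum (fun q => ham p q.1) ψ = fun q =>
      ((∑ j : Fin n, (if j.val < p then q.1 j * (m j : ℝ) else 0) - ham p q.1 : ℝ) : ℂ) * ψ q := by
  funext q
  rw [hψ.prequantum_comp_fst (hasFDerivAt_ham p q.1)]
  congr 2
  have : (∑ j : Fin n, (if j.val < p then q.1 j else 0) * ((m j : ℝ) - q.1 j)) =
      ∑ j : Fin n, (if j.val < p then q.1 j * (m j : ℝ) else 0) - 2 * ham p q.1 := by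
    rw [ham, ← mul_assoc, mul_one_div_cancel two_ne_zero, one_mul, ← Finset.sum_sub_distrib]
    refine Finset.sum_congr rfl fun j _ => ?_
    split_ifs <;> ring
  rw [this]
  ring

/-- Multiplication by a function of `x` preserves the weight, so the hypothesis on `A` can be
iterated and the operator series becomes the scalar exponential series at each point. -/
theorem HasWeight.opExp_eq {A : (Phase n → ℂ) → Phase n → ℂ} {c : (Fin n → ℝ) → ℂ}
    (hA : ∀ φ, HasWeight m φ → A φ = fun q => c q.1 * φ q) (hψ : HasWeight m ψ) (t : ℂ) :
    opExp A t ψ = fun q => Complex.exp (t * c q.1) * ψ q := by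
  have h : ∀ k : ℕ, A^[k] ψ = fun q => c q.1 ^ k * ψ q := by
    intro k
    induction k with
    | zero => simp
    | succ k ih =>
      rw [Function.iterate_succ_apply', ih, hA _ (hψ.mul_fst fun x => c x ^ k)]
      funext q
      ring
  funext q
  rw [opExp, Complex.exp_eq_exp_ℂ, NormedSpace.exp_eq_tsum_div, ← tsum_mul_right]
  refine tsum_congr fun k => ?_
  rw [h, smul_eq_mul, mul_pow]
  ring

end Weight

/-! ### The coherent state transform of the monomial sections -/

section Transform

variable {n d : ℕ} (P : DelzantPolytope n d) (p : ℕ) (s : ℝ) (m : Fin n → ℤ)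

theorem hasWeight_monomialSection : HasWeight m (monomialSection P p s m).coeff := by
  intro x θ τ
  simp only [monomialSection]
  by_cases hx : x ∈ interior P.carrier
  · rw [Set.indicator_of_mem (show (x, θ + τ) ∈ openOrbit P from hx),
      Set.indicator_of_mem (show (x, θ) ∈ openOrbit P from hx), ← mul_assoc]
    congr 1
    simp only [← Complex.exp_int_mul, ← Complex.exp_sum, ← Complex.exp_add]
    congr 1
    simp only [zCoord, Pi.add_apply]
    push_cast
    rw [Finset.mul_sum, ← Finset.sum_add_distrib]
    exact Finset.sum_congr rfl fun j _ => by ring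
  · rw [Set.indicator_of_notMem (show (x, θ + τ) ∉ openOrbit P from hx),
      Set.indicator_of_notMem (show (x, θ) ∉ openOrbit P from hx), mul_zero]

theorem quantumHam_monomialSection :
    quantumHam p (monomialSection P p s m).coeff =
      ((ham p (fun i => (m i : ℝ)) : ℝ) : ℂ) • (monomialSection P p s m).coeff :=
  (hasWeight_monomialSection P p s m).quantumHam_eq p

variable {P p s m}

theorem gradPotential_eq (j : Fin n) (x : Fin n → ℝ) :
    gradPotential P p s j x =
      gradPotential P p 0 j x + s * if j.val < p then x j else 0 := by
  simp [gradPotential]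

theorem monomialSection_coeff {q : Phase n} (hq : q ∈ openOrbit P) :
    (monomialSection P p s m).coeff q =
      Complex.exp (((∑ j, m j * gradPotential P p s j q.1 -
        (∑ j, q.1 j * gradPotential P p s j q.1 - potential P p s q.1) : ℝ) : ℂ) +
          Complex.I * ((∑ j, (m j : ℝ) * q.2 j : ℝ) : ℂ)) := by
  simp only [monomialSection]
  rw [Set.indicator_of_mem hq]
  simp only [← Complex.exp_int_mul, ← Complex.exp_sum, ← Complex.exp_add]
  congr 1
  simp only [zCoord, kahlerPotential, partialDeriv_potential p s (show q.1 ∈ _ from hq)]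
  push_cast
  simp only [mul_add, Finset.sum_add_distrib, Finset.mul_sum, mul_left_comm Complex.I]
  ring

/-- The exponent gains `s(∑_{j≤p} m^j x^j - H(x))` from `Ĥ^{prQ}`. The same amount results from
replacing `g_P` by `g_s`: the gradient contributes `s ∑_{j≤p} m^j x^j - 2sH`, and `g_s` itself
contributes `sH`. -/
theorem gcst_monomialSection_coeff :
    (gcst p s (monomialSection P p 0 m)).coeff =
      Complex.exp (-(s : ℂ) * ((ham p (fun i => (m i : ℝ)) : ℝ) : ℂ)) •
        (monomialSection P p s m).coeff := by
  have hw := hasWeight_monomialSection P p 0 m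
  simp only [gcst]
  rw [hw.opExp_eq (A := quantumHam p) (c := fun _ => ((ham p (fun i => (m i : ℝ)) : ℝ) : ℂ))
      fun φ hφ => hφ.quantumHam_eq p,
    (hw.mul_fst fun _ => Complex.exp
      (-(s : ℂ) * ((ham p (fun i => (m i : ℝ)) : ℝ) : ℂ))).opExp_eq (A := prequantum fun q => ham p q.1)
      (c := fun x => ((∑ j : Fin n, (if j.val < p then x j * (m j : ℝ) else 0) - ham p x : ℝ) : ℂ))
      fun φ hφ => hφ.prequantum_ham p]
  funext q
  simp only [Pi.smul_apply, smul_eq_mul]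
  by_cases hq : q ∈ openOrbit P
  · rw [monomialSection_coeff hq, monomialSection_coeff hq]
    simp only [← Complex.exp_add]
    congr 1
    have h1 : ∑ j, (m j : ℝ) * gradPotential P p s j q.1 =
        ∑ j, (m j : ℝ) * gradPotential P p 0 j q.1 +
          s * ∑ j : Fin n, (if j.val < p then q.1 j * (m j : ℝ) else 0) := by
      rw [Finset.mul_sum, ← Finset.sum_add_distrib]
      refine Finset.sum_congr rfl fun j _ => ?_
      rw [gradPotential_eq]
      split_ifs <;> ring
    have h2 : ∑ j, q.1 j * gradPotential P p s j q.1 =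
        ∑ j, q.1 j * gradPotential P p 0 j q.1 + s * (2 * ham p q.1) := by
      rw [ham, ← mul_assoc 2, mul_one_div_cancel two_ne_zero, one_mul, Finset.mul_sum,
        ← Finset.sum_add_distrib]
      refine Finset.sum_congr rfl fun j _ => ?_
      rw [gradPotential_eq]
      split_ifs <;> ring
    rw [h1, h2]
    simp only [potential]
    push_cast
    ring
  · have h : ∀ t, (monomialSection P p t m).coeff q = 0 := fun t => by
      simp only [monomialSection]
      exact Set.indicator_of_notMem hq _
    simp [h]

variable (P p s m)

/-- The unitary character of the additive group `ℝⁿ` given by an integral weight. -/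
def angleCharacter {n : ℕ} (m : Fin n → ℤ) : Multiplicative (Fin n → ℝ) →* ℂ where
  toFun τ := Complex.exp (Complex.I * ((∑ j, (m j : ℝ) * τ.toAdd j : ℝ) : ℂ))
  map_one' := by simp
  map_mul' τ τ' := by
    rw [← Complex.exp_add, ← mul_add, ← Complex.ofReal_add, ← Finset.sum_add_distrib]
    simp [mul_add]

theorem angleCharacter_injective {n : ℕ} :
    Function.Injective (angleCharacter : (Fin n → ℤ) → _) := by
  intro m m' h
  by_contra hne
  obtain ⟨j, hj⟩ := Function.ne_iff.1 hne
  have hj' : (m j : ℂ) - m' j ≠ 0 := sub_ne_zero.2 (by exact_mod_cast hj)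
  -- At this translation the two characters differ by the factor `e^{iπ} = -1`, although equality
  -- was assumed.
  have h1 := DFunLike.congr_fun h
    (Multiplicative.ofAdd (Pi.single j (Real.pi / ((m j : ℝ) - m' j))))
  simp only [angleCharacter, MonoidHom.coe_mk, OneHom.coe_mk, toAdd_ofAdd, Pi.single_apply,
    mul_ite, mul_zero, Finset.sum_ite_eq', Finset.mem_univ, if_true] at h1
  have h2 : Complex.exp (Complex.I * ((m j * (Real.pi / ((m j : ℝ) - m' j)) : ℝ) : ℂ)) =
      Complex.exp (Real.pi * Complex.I) *
        Complex.exp (Complex.I * ((m' j * (Real.pi / ((m j : ℝ) - m' j)) : ℝ) : ℂ)) := by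
    rw [← Complex.exp_add]
    congr 1
    push_cast
    field_simp
    ring
  rw [h2, Complex.exp_pi_mul_I] at h1
  have h3 := Complex.exp_ne_zero (Complex.I * ((m' j * (Real.pi / ((m j : ℝ) - m' j)) : ℝ) : ℂ))
  apply h3
  linear_combination (-1 / 2 : ℂ) * h1

/-- Restriction to the torus fibre over one interior point gives nonzero multiples of distinct
characters, which are independent by Dedekind's theorem. -/
theorem linearIndependent_monomialSection :
    LinearIndependent ℂ fun m : P.latticePoints => (monomialSection P p s m.1).coeff := by
  obtain ⟨x, hx⟩ := P.interior_carrier_nonempty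
  let R : (Phase n → ℂ) →ₗ[ℂ] (Multiplicative (Fin n → ℝ) → ℂ) :=
    LinearMap.funLeft ℂ ℂ fun τ => (x, τ.toAdd)
  have hne : ∀ m, (monomialSection P p s m).coeff (x, 0) ≠ 0 := fun m => by
    rw [monomialSection_coeff (show ((x, 0) : Phase n) ∈ openOrbit P from hx)]
    exact Complex.exp_ne_zero _
  have hR : (R ∘ fun m : P.latticePoints => (monomialSection P p s m.1).coeff) =
      (fun m : P.latticePoints => Units.mk0 _ (hne m.1)) •
        fun m : P.latticePoints => (angleCharacter m.1 : Multiplicative (Fin n → ℝ) → ℂ) := by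
    funext m τ
    have := hasWeight_monomialSection P p s m.1 x 0 τ.toAdd
    simp only [zero_add] at this
    simp only [R, Function.comp_apply, LinearMap.funLeft_apply, this, Pi.smul_apply', Pi.smul_apply,
      Units.smul_def, Units.val_mk0, smul_eq_mul]
    exact mul_comm _ _
  refine LinearIndependent.of_comp R ?_
  rw [hR]
  refine LinearIndependent.units_smul ?_ _
  exact (linearIndependent_monoidHom (Multiplicative (Fin n → ℝ)) ℂ).comp
    (fun m : P.latticePoints => angleCharacter m.1)
    (angleCharacter_injective.comp Subtype.val_injective)

/-! The action on half-forms. -/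

/-- The differential of the Hamiltonian vector field of `H`. -/
def hamVFDeriv (n p : ℕ) : Phase n →L[ℝ] Phase n :=
  (ContinuousLinearMap.inr ℝ (Fin n → ℝ) (Fin n → ℝ)).comp
    ((ContinuousLinearMap.pi fun j : Fin n => if j.val < p then
        -ContinuousLinearMap.proj (R := ℝ) (φ := fun _ : Fin n => ℝ) j else 0).comp
      (ContinuousLinearMap.fst ℝ (Fin n → ℝ) (Fin n → ℝ)))

theorem hamVFDeriv_apply (v : Phase n) :
    hamVFDeriv n p v = (0, fun j : Fin n => if j.val < p then -v.1 j else 0) := by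
  simp only [hamVFDeriv, ContinuousLinearMap.comp_apply, ContinuousLinearMap.inr_apply]
  congr 1
  funext j
  simp only [ContinuousLinearMap.coe_pi', ContinuousLinearMap.coe_fst']
  split_ifs <;> simp

theorem hamVF_ham : hamVF (fun q : Phase n => ham p q.1) = hamVFDeriv n p := by
  funext q
  rw [hamVF_comp_fst (hasFDerivAt_ham p q.1), hamVFDeriv_apply]
  congr 1
  funext j
  split_ifs <;> simp

/-- `X_H` is tangent to the angle directions, so the transport term of the Lie derivative vanishes
on angle-invariant forms. -/
theorem lieDeriv_ham {η : Phase n → (Phase n →L[ℝ] ℂ)} (hη : ∀ x θ θ', η (x, θ) = η (x, θ')) :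
    lieDeriv (hamVF fun q => ham p q.1) η = fun q => (η q).comp (hamVFDeriv n p) := by
  funext q
  rw [hamVF_ham, lieDeriv, (hamVFDeriv n p).fderiv]
  have : lineDeriv ℝ η q (hamVFDeriv n p q) = 0 := by
    have h : (fun t : ℝ => η (q + t • hamVFDeriv n p q)) = fun _ => η q := by
      funext t
      rw [hamVFDeriv_apply]
      have : ∀ v, q + t • ((0, v) : Phase n) = (q.1, q.2 + t • v) := fun v => by ext <;> simp
      rw [this]
      exact hη _ _ _
    rw [lineDeriv, h, deriv_const]
  rw [this, zero_add]

theorem gcst_monomialSection_form : (gcst p s (monomialSection P p 0 m)).form = dZ P p s := by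
  have hinv : ∀ t j x θ θ', dZ P p t j (x, θ) = dZ P p t j (x, θ') := by
    intro t j x θ θ'
    by_cases hx : x ∈ interior P.carrier
    · have h1 : (x, θ) ∈ openOrbit P := hx
      have h2 : (x, θ') ∈ openOrbit P := hx
      rw [dZ, Set.indicator_of_mem h1, Set.indicator_of_mem h2,
        (hasFDerivAt_zCoord p t h1 j).fderiv, (hasFDerivAt_zCoord p t h2 j).fderiv]
    · rw [dZ, Set.indicator_of_notMem (show (x, θ) ∉ openOrbit P from hx),
        Set.indicator_of_notMem (show (x, θ') ∉ openOrbit P from hx)]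
  -- The differential of `X_H` sends `x`-directions to angle directions and kills the latter; this
  -- is why the exponential series stops after its linear term.
  have hsq : (hamVFDeriv n p).comp (hamVFDeriv n p) = 0 := by
    ext v <;> simp [hamVFDeriv_apply]
  funext j q
  simp only [gcst, monomialSection, opExp]
  set L := lieDeriv (hamVF fun q : Phase n => ham p q.1)
  have hLη : ∀ η : Phase n → (Phase n →L[ℝ] ℂ), (∀ x θ θ', η (x, θ) = η (x, θ')) →
      L η = fun q => (η q).comp (hamVFDeriv n p) := fun η hη => lieDeriv_ham p hη
  have e1 : L (dZ P p 0 j) = fun q => (dZ P p 0 j q).comp (hamVFDeriv n p) :=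
    hLη _ (hinv 0 j)
  have e2 : L^[2] (dZ P p 0 j) = 0 := by
    rw [Function.iterate_succ_apply', Function.iterate_one, e1,
      hLη _ fun x θ θ' => by rw [hinv 0 j x θ θ']]
    funext q
    rw [ContinuousLinearMap.comp_assoc, hsq, ContinuousLinearMap.comp_zero, Pi.zero_apply]
  have e3 : ∀ k, L^[k + 2] (dZ P p 0 j) = 0 := by
    intro k
    induction k with
    | zero => exact e2
    | succ k ih =>
      rw [Nat.add_right_comm, Function.iterate_succ_apply', ih,
        hLη 0 fun _ _ _ => rfl]
      rfl
  rw [tsum_eq_sum (s := Finset.range 2)]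
  · rw [Finset.sum_range_succ, Finset.sum_range_one, Function.iterate_zero_apply,
      Function.iterate_one, e1]
    by_cases hq : q ∈ openOrbit P
    · simp only [dZ, Set.indicator_of_mem hq, (hasFDerivAt_zCoord p _ hq j).fderiv]
      refine ContinuousLinearMap.ext fun v => ?_
      have h : ∀ t, ∑ k, hessPotential P p t q.1 j k * v.1 k =
          ∑ k, 1 / 2 * (∑ r, (P.normal r j : ℝ) * (P.normal r k : ℝ) / P.ell r q.1) * v.1 k +
            t * if j.val < p then v.1 j else 0 := by
        intro t
        simp only [hessPotential, Matrix.of_apply, add_mul, Finset.sum_add_distrib]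
        congr 1
        by_cases hj : j.val < p <;> simp [hj]
      simp [hamVFDeriv_apply, h]
      split_ifs
      · push_cast
        linear_combination (-(s : ℂ) * (v.1 j : ℂ)) * Complex.I_mul_I
      · simp
    · simp [dZ, Set.indicator_of_notMem hq]
  · intro k hk
    obtain ⟨l, rfl⟩ : ∃ l, k = l + 2 := ⟨k - 2, by simp at hk; omega⟩
    rw [e3, Pi.zero_apply, smul_zero]

end Transform

/-! ### Determinants of the Hessians

The determinant of the Hessian of `g_s` is singular at the boundary of the polytope. Multiplied by
`∏_r l_r` it becomes, by the Schur complement formula, the determinant of a block matrix with affine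
entries. -/

section Determinant

variable {n d : ℕ} (P : DelzantPolytope n d) (p : ℕ)

/-- A block matrix with affine entries whose Schur complement is the Hessian of `g_P`, with its
first `p` rows multiplied by `a`, plus `b` times the identity of the first `p` coordinates. -/
def extMatrix (a b : ℝ) (x : Fin n → ℝ) : Matrix (Fin d ⊕ Fin n) (Fin d ⊕ Fin n) ℝ :=
  Matrix.fromBlocks (Matrix.diagonal fun r => P.ell r x)
    (Matrix.of fun r k => 1 / 2 * (P.normal r k : ℝ))
    (Matrix.of fun j r => -((if j.val < p then a else 1) * (P.normal r j : ℝ)))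
    (Matrix.diagonal fun j => if j.val < p then b else 0)

theorem continuous_det_extMatrix {X : Type*} [TopologicalSpace X] {a b : X → ℝ}
    {f : X → Fin n → ℝ} (ha : Continuous a) (hb : Continuous b) (hf : Continuous f) :
    Continuous fun t => (extMatrix P p (a t) (b t) (f t)).det := by
  refine Continuous.matrix_det (continuous_matrix fun i j => ?_)
  have := fun r => P.continuous_ell r
  rcases i with i | i <;> rcases j with j | j <;>
    simp only [extMatrix, Matrix.fromBlocks_apply₁₁, Matrix.fromBlocks_apply₁₂,
      Matrix.fromBlocks_apply₂₁, Matrix.fromBlocks_apply₂₂, Matrix.diagonal_apply,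
      Matrix.of_apply] <;> (try split_ifs) <;> fun_prop

theorem prod_ite_val_lt {R : Type*} [CommMonoid R] (hp : p ≤ n) (s : R) :
    ∏ j : Fin n, (if j.val < p then s else 1) = s ^ p := by
  rw [Finset.prod_ite, Finset.prod_const, Finset.prod_const_one, mul_one]
  congr 1
  rw [Fin.card_filter_val_lt]
  omega

/-- A factor `s` is taken out of each of the first `p` Hessian rows. The remaining matrix has a
limit as `s → ∞`. -/
theorem det_extMatrix_scale (hp : p ≤ n) {s : ℝ} (hs : s ≠ 0) (x : Fin n → ℝ) :
    (extMatrix P p 1 s x).det = s ^ p * (extMatrix P p s⁻¹ 1 x).det := by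
  have h : extMatrix P p 1 s x = Matrix.diagonal
      (Sum.elim (fun _ => 1) fun j : Fin n => if j.val < p then s else 1) *
        extMatrix P p s⁻¹ 1 x := by
    ext i j
    rw [Matrix.diagonal_mul]
    rcases i with i | i <;> rcases j with j | j <;>
      simp only [extMatrix, Matrix.fromBlocks_apply₁₁, Matrix.fromBlocks_apply₁₂,
        Matrix.fromBlocks_apply₂₁, Matrix.fromBlocks_apply₂₂, Matrix.diagonal_apply,
        Matrix.of_apply, Sum.elim_inl, Sum.elim_inr] <;> (try split_ifs) <;> (field_simp; try ring)
  rw [h, Matrix.det_mul, Matrix.det_diagonal, Fintype.prod_sum_type]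
  simp [prod_ite_val_lt p hp]

variable {P} {x : Fin n → ℝ}

/-- Schur complement with respect to the diagonal block of the `l_r`, which is invertible in the
interior. -/
theorem det_extMatrix (hx : x ∈ interior P.carrier) (a b : ℝ) :
    (extMatrix P p a b x).det = (∏ r, P.ell r x) * (Matrix.of fun j k : Fin n =>
      (if j.val < p then a else 1) * hessPotential P p 0 x j k +
        b * if j = k ∧ j.val < p then 1 else 0).det := by
  have hne : ∀ r, P.ell r x ≠ 0 := fun r => (P.mem_interior_carrier.1 hx r).ne'
  have hmul : ∀ f g : Fin d → ℝ, (∀ r, f r * g r = 1) →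
      Matrix.diagonal f * Matrix.diagonal g = 1 := fun f g h => by
    rw [Matrix.diagonal_mul_diagonal, ← Matrix.diagonal_one]
    exact congrArg _ (funext h)
  let _ : Invertible (Matrix.diagonal fun r => P.ell r x) :=
    ⟨Matrix.diagonal fun r => (P.ell r x)⁻¹, hmul _ _ fun r => inv_mul_cancel₀ (hne r),
      hmul _ _ fun r => mul_inv_cancel₀ (hne r)⟩
  have hinv : ⅟(Matrix.diagonal fun r => P.ell r x) = Matrix.diagonal fun r => (P.ell r x)⁻¹ := rfl
  rw [extMatrix, Matrix.det_fromBlocks₁₁, Matrix.det_diagonal, hinv]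
  congr 2
  ext j k
  rw [Matrix.sub_apply, Matrix.mul_apply]
  simp only [Matrix.mul_diagonal, Matrix.of_apply, Matrix.diagonal_apply, hessPotential, zero_mul,
    add_zero]
  have : (if j = k then if j.val < p then b else 0 else 0) =
      b * if j = k ∧ j.val < p then 1 else 0 := by
    by_cases h1 : j = k <;> by_cases h2 : j.val < p <;> simp [h1, h2]
  rw [this, sub_eq_add_neg, add_comm, ← Finset.sum_neg_distrib, Finset.mul_sum, Finset.mul_sum]
  congr 1
  refine Finset.sum_congr rfl fun r _ => by ring

theorem det_hessPotential (hx : x ∈ interior P.carrier) (s : ℝ) :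
    (hessPotential P p s x).det = (∏ r, P.ell r x)⁻¹ * (extMatrix P p 1 s x).det := by
  have hne : ∏ r, P.ell r x ≠ 0 :=
    Finset.prod_ne_zero_iff.2 fun r _ => (P.mem_interior_carrier.1 hx r).ne'
  rw [det_extMatrix p hx, inv_mul_cancel_left₀ hne]
  congr 1
  ext j k
  simp [hessPotential]

/-- For `a = 0`, `b = 1` the first `p` rows of the Schur complement are those of the identity, so
its determinant is that of the lower right block. -/
theorem det_lowerBlock (hx : x ∈ interior P.carrier) :
    (lowerBlock P p x).det = (∏ r, P.ell r x)⁻¹ * (extMatrix P p 0 1 x).det := by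
  have hne : ∏ r, P.ell r x ≠ 0 :=
    Finset.prod_ne_zero_iff.2 fun r _ => (P.mem_interior_carrier.1 hx r).ne'
  rw [det_extMatrix p hx, inv_mul_cancel_left₀ hne,
    Matrix.twoBlockTriangular_det' _ fun j : Fin n => j.val < p]
  · have h1 : Matrix.toSquareBlockProp (Matrix.of fun j k : Fin n =>
        (if j.val < p then (0 : ℝ) else 1) * hessPotential P p 0 x j k +
          1 * if j = k ∧ j.val < p then 1 else 0) (fun j => j.val < p) = 1 := by
      ext j k
      have : j.1.val < p := j.2
      simp [Matrix.toSquareBlockProp, Matrix.one_apply, Subtype.ext_iff, this]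
    rw [h1, Matrix.det_one, one_mul, ← Matrix.det_transpose, ← Matrix.det_submatrix_equiv_self
      (Equiv.subtypeEquivRight fun j : Fin n => (not_lt (a := j.val) (b := p)))]
    congr 1
    ext j k
    have : ¬ j.1.val < p := j.2
    simp only [Matrix.submatrix_apply, Matrix.transpose_apply, lowerBlock,
      hessian_guillemin p hx, Matrix.toSquareBlockProp, Matrix.toBlock_apply, Matrix.of_apply,
      Equiv.subtypeEquivRight_apply_coe, this, and_false, if_false]
    ring
  · intro i hi j hj
    have : i ≠ j := fun h => hj (h ▸ hi)
    simp [hi, this]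

theorem canonicalNorm_dZ {q : Phase n} (hq : q ∈ openOrbit P) (s : ℝ) :
    canonicalNorm (dZ P p s) q = Real.sqrt (hessPotential P p s q.1).det := by
  rw [canonicalNorm]
  congr 1
  set G : Matrix (Fin n) (Fin n) ℂ := (hessPotential P p s q.1).map Complex.ofRealHom with hG
  -- Row reduction: subtracting the `dz` rows from the `dz̄` rows leaves only `-2i` on the angle
  -- block. The factor `(-2i)^n` then cancels against the normalization of `ωⁿ/n!`.
  have h1 : (Matrix.of fun a b : Fin n ⊕ Fin n =>
        Sum.elim (fun j => dZ P p s j q (frame b))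
          (fun j => (starRingEnd ℂ) (dZ P p s j q (frame b))) a) =
      Matrix.fromBlocks 1 0 1 1 * Matrix.fromBlocks G (Matrix.diagonal fun _ => Complex.I) 0
        (Matrix.diagonal fun _ => -2 * Complex.I) := by
    rw [Matrix.fromBlocks_multiply]
    ext a b
    rcases a with a | a <;> rcases b with b | b <;>
      simp [dZ_frame_inl p s hq, dZ_frame_inr p s hq, G, Matrix.diagonal_apply]
    · split_ifs <;> simp
      ring
  have h2 : n * (n + 1) / 2 = n * (n - 1) / 2 + n := by
    have := Nat.triangle_succ n
    rw [mul_comm n (n + 1)]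
    simpa using this
  have h3 : ((-1 : ℂ)) ^ (n * (n + 1) / 2) * (-1) ^ (n * (n - 1) / 2) = (-1) ^ n := by
    rw [h2, pow_add, mul_right_comm, ← mul_pow]
    simp
  rw [h1, Matrix.det_mul, Matrix.det_fromBlocks_zero₁₂, Matrix.det_fromBlocks_zero₂₁,
    Matrix.det_diagonal, Finset.prod_const, Finset.card_univ, Fintype.card_fin, mul_assoc ((2 * _) ^ _),
    h3, ← mul_pow, hG, ← RingHom.mapMatrix_apply, ← RingHom.map_det, Matrix.det_one, one_mul, one_mul]
  have h4 : (2 * Complex.I * -1) = -2 * Complex.I := by ring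
  rw [h4, mul_div_assoc, div_self (pow_ne_zero _ (by simp)), mul_one]
  simp

end Determinant

/-! ### The densities of the norms -/

section Density

variable {n d : ℕ} (P : DelzantPolytope n d) (p : ℕ) (m : Fin n → ℤ)

/-- The function `∏_r l_r(x)^{l_r(m) - 1/2} e^{l_r(m) - l_r(x)}`. -/
def weightDensity (x : Fin n → ℝ) : ℝ :=
  ∏ r, P.ell r x ^ (P.ell r (fun i => (m i : ℝ)) - 1 / 2) *
    Real.exp (P.ell r (fun i => (m i : ℝ)) - P.ell r x)

variable {P} {m}

/-- Real powers with nonnegative exponent are continuous through zero, so continuity holds on all of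
`ℝⁿ`, boundary included. -/
theorem continuous_weightDensity (hP : P.HalfIntegral) (hm : m ∈ P.latticePoints) :
    Continuous (weightDensity P m) := by
  unfold weightDensity
  refine continuous_finsetProd _ fun r _ => ?_
  have := P.continuous_ell r
  exact (this.rpow_const fun x => Or.inr (sub_nonneg.2 (hP.half_le_ell hm r))).mul
    (Real.continuous_exp.comp (continuous_const.sub this))

variable {x : Fin n → ℝ}

/-- Pairing `x - m` with the normals gives `l_r(x) - l_r(m)`; the terms `l_r log l_r` then cancel
against `g_P`, leaving `l_r(m) log l_r(x) + l_r(m) - l_r(x)` for each facet. -/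
theorem exp_legendre_guillemin (hx : x ∈ interior P.carrier) :
    Real.exp (-2 * (∑ j, (x j - m j) * gradPotential P p 0 j x - guillemin P x)) =
      weightDensity P m x * Real.sqrt (∏ r, P.ell r x) := by
  have hpos := P.mem_interior_carrier.1 hx
  have h1 : ∑ j, (x j - m j) * gradPotential P p 0 j x =
      1 / 2 * ∑ r, (P.ell r x - P.ell r fun i => (m i : ℝ)) * (Real.log (P.ell r x) + 1) := by
    simp only [gradPotential, zero_mul, add_zero, Finset.mul_sum, DelzantPolytope.ell,
      add_sub_add_right_eq_sub, ← Finset.sum_sub_distrib, Finset.sum_mul]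
    rw [Finset.sum_comm]
    exact Finset.sum_congr rfl fun _ _ => Finset.sum_congr rfl fun _ _ => by ring
  rw [h1, guillemin, ← mul_sub, ← Finset.sum_sub_distrib, ← mul_assoc, Finset.mul_sum,
    Real.exp_sum, weightDensity, Real.sqrt_eq_rpow,
    ← Real.finsetProd_rpow _ _ fun r _ => (hpos r).le, ← Finset.prod_mul_distrib]
  refine Finset.prod_congr rfl fun r _ => ?_
  rw [mul_right_comm (_ ^ _), ← Real.rpow_add (hpos r), Real.rpow_def_of_pos (hpos r), ← Real.exp_add]
  congr 1
  ring

theorem limitDensity_eq (hx : x ∈ interior P.carrier) :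
    limitDensity P p m x = weightDensity P m x * Real.sqrt (extMatrix P p 0 1 x).det := by
  have hpos : 0 < ∏ r, P.ell r x :=
    Finset.prod_pos fun r _ => P.mem_interior_carrier.1 hx r
  simp only [limitDensity, partialDeriv_guillemin p hx]
  rw [exp_legendre_guillemin p hx, det_lowerBlock p hx, Real.sqrt_mul (inv_nonneg.2 hpos.le),
    Real.sqrt_inv, mul_assoc, mul_inv_cancel_left₀ (Real.sqrt_pos.2 hpos).ne']

/-- The density of the squared norm of `U_s σ^m_0`, as a function on the polytope. -/
def normDensity (P : DelzantPolytope n d) (p : ℕ) (m : Fin n → ℤ) (s : ℝ) (x : Fin n → ℝ) : ℝ :=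
  Real.exp (-s * ∑ j : Fin n, if j.val < p then (x j - m j) ^ 2 else 0) *
    (weightDensity P m x * Real.sqrt (extMatrix P p 1 s x).det)

/-- The `s`-dependent exponents `-2sH(m)`, `2s ∑_{j≤p} m^j x^j` and `-2sH(x)` complete to a square
centred at `m`. -/
theorem pointNormSq_gcst {q : Phase n} (hq : q ∈ openOrbit P) (s : ℝ) :
    pointNormSq (gcst p s (monomialSection P p 0 m)) q = normDensity P p m s q.1 := by
  have hx : q.1 ∈ interior P.carrier := hq
  have hpos : 0 < ∏ r, P.ell r q.1 :=
    Finset.prod_pos fun r _ => P.mem_interior_carrier.1 hx r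
  rw [pointNormSq, gcst_monomialSection_form, gcst_monomialSection_coeff, canonicalNorm_dZ p hq,
    det_hessPotential p hx, Real.sqrt_mul (inv_nonneg.2 hpos.le), Real.sqrt_inv, Pi.smul_apply,
    monomialSection_coeff hq, smul_eq_mul, norm_mul, Complex.norm_exp, Complex.norm_exp, normDensity]
  have hw : weightDensity P m q.1 = Real.exp (-2 * (∑ j, (q.1 j - m j) *
      gradPotential P p 0 j q.1 - guillemin P q.1)) * (Real.sqrt (∏ r, P.ell r q.1))⁻¹ := by
    rw [exp_legendre_guillemin p hx, mul_assoc, mul_inv_cancel₀ (Real.sqrt_pos.2 hpos).ne', mul_one]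
  rw [hw, ← Real.exp_add, ← Real.exp_nat_mul, ← mul_assoc, ← mul_assoc, ← mul_assoc, ← Real.exp_add]
  congr 3
  have h1 : (-(s : ℂ) * ((ham p fun i => (m i : ℝ) : ℝ) : ℂ)).re =
      -s * ham p fun i => (m i : ℝ) := by
    rw [← Complex.ofReal_neg, ← Complex.ofReal_mul, Complex.ofReal_re]
  rw [h1, Complex.add_re, Complex.ofReal_re, Complex.re_mul_ofReal, Complex.I_re, zero_mul,
    add_zero]
  have h2 : ∀ f : Fin n → ℝ, ∑ j, f j * gradPotential P p s j q.1 =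
      ∑ j, f j * gradPotential P p 0 j q.1 +
        s * ∑ j : Fin n, (if j.val < p then f j * q.1 j else 0) := by
    intro f
    rw [Finset.mul_sum, ← Finset.sum_add_distrib]
    refine Finset.sum_congr rfl fun j _ => ?_
    rw [gradPotential_eq]
    split_ifs <;> ring
  have h3 : ∑ j : Fin n, (if j.val < p then (q.1 j - m j) ^ 2 else 0) =
      ∑ j : Fin n, (if j.val < p then q.1 j ^ 2 else 0) +
        ∑ j : Fin n, (if j.val < p then (m j : ℝ) ^ 2 else 0) -
          2 * ∑ j : Fin n, (if j.val < p then (m j : ℝ) * q.1 j else 0) := by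
    rw [Finset.mul_sum, ← Finset.sum_add_distrib, ← Finset.sum_sub_distrib]
    refine Finset.sum_congr rfl fun j _ => ?_
    split_ifs <;> ring
  have h4 : ∑ j : Fin n, (if j.val < p then q.1 j * q.1 j else 0) =
      ∑ j : Fin n, (if j.val < p then q.1 j ^ 2 else 0) := by simp only [sq]
  simp only [h2, h3, h4, potential, ham, sub_mul, Finset.sum_sub_distrib]
  push_cast
  ring

end Density

/-! ### The delta measure -/

section Slice

variable {n d : ℕ} (p : ℕ) (m : Fin n → ℤ)

/-- The parametrization of the slice `{x | x^j = m^j for j < p}` by the remaining coordinates. -/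
def sliceMap (b : {j : Fin n // ¬j.val < p} → ℝ) : Fin n → ℝ :=
  fun j => if h : j.val < p then (m j : ℝ) else b ⟨j, h⟩

theorem measurable_sliceMap : Measurable (sliceMap p m) := by
  refine measurable_pi_lambda _ fun j => ?_
  unfold sliceMap
  split_ifs
  · exact measurable_const
  · exact measurable_pi_apply _

instance sigmaFinite_ite_dirac (j : Fin n) :
    SigmaFinite (if j.val < p then Measure.dirac (m j : ℝ) else volume) := by
  split_ifs <;> infer_instance

instance isLocallyFiniteMeasure_ite_dirac (j : Fin n) :
    IsLocallyFiniteMeasure (if j.val < p then Measure.dirac (m j : ℝ) else volume) := by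
  split_ifs <;> infer_instance

instance isLocallyFiniteMeasure_deltaMeasure : IsLocallyFiniteMeasure (deltaMeasure p m) :=
  Measure.pi.isLocallyFiniteMeasure

/-- It suffices to compare boxes: if some fixed coordinate `m^j` misses its side, both measures
vanish; otherwise the Dirac factors are all `1`. -/
theorem map_sliceMap : Measure.map (sliceMap p m) volume = deltaMeasure p m := by
  symm
  rw [deltaMeasure]
  refine Measure.pi_eq fun t ht => ?_
  rw [Measure.map_apply (measurable_sliceMap p m) (MeasurableSet.univ_pi ht),
    ← Fintype.prod_subtype_mul_prod_subtype (fun j : Fin n => j.val < p)]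
  have h2 : ∏ j : {j : Fin n // ¬j.val < p},
      (if j.1.val < p then Measure.dirac (m j.1 : ℝ) else volume) (t j.1) =
        volume (Set.univ.pi fun j : {j : Fin n // ¬j.val < p} => t j.1) := by
    rw [volume_pi_pi]
    exact Finset.prod_congr rfl fun j _ => by rw [if_neg j.2]
  have h1 : ∏ j : {j : Fin n // j.val < p},
      (if j.1.val < p then Measure.dirac (m j.1 : ℝ) else volume) (t j.1) =
        ∏ j : {j : Fin n // j.val < p}, (t j.1).indicator 1 (m j.1 : ℝ) :=
    Finset.prod_congr rfl fun j _ => by rw [if_pos j.2, Measure.dirac_apply' _ (ht _)]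
  rw [h1, h2]
  by_cases h : ∀ j : {j : Fin n // j.val < p}, (m j.1 : ℝ) ∈ t j.1
  · rw [Finset.prod_eq_one fun j _ => Set.indicator_of_mem (h j) 1, one_mul]
    congr 1
    ext b
    simp only [Set.mem_preimage, Set.mem_univ_pi]
    refine ⟨fun hb j => by simpa [sliceMap, j.2] using hb j.1, fun hb j => ?_⟩
    by_cases hj : j.val < p
    · simpa [sliceMap, hj] using h ⟨j, hj⟩
    · simpa [sliceMap, hj] using hb ⟨j, hj⟩
  · push Not at h
    obtain ⟨j, hj⟩ := h
    rw [Finset.prod_eq_zero (Finset.mem_univ j) (Set.indicator_of_notMem hj _), zero_mul]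
    convert measure_empty (μ := (volume : Measure ({j : Fin n // ¬j.val < p} → ℝ)))
    refine Set.eq_empty_of_forall_notMem fun b hb => hj ?_
    have := Set.mem_univ_pi.1 hb j.1
    simpa [sliceMap, j.2] using this

/-- The projection onto the slice `{x | x^j = m^j for j < p}`. -/
def sliceProj (u : Fin n → ℝ) : Fin n → ℝ :=
  fun j => if j.val < p then (m j : ℝ) else u j

theorem sliceProj_eq (u : Fin n → ℝ) :
    sliceProj p m u = sliceMap p m
      (MeasurableEquiv.piEquivPiSubtypeProd (fun _ : Fin n => ℝ) (fun j => j.val < p) u).2 := by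
  funext j
  by_cases h : j.val < p
  · simp [sliceProj, sliceMap, h]
  · simp only [sliceProj, sliceMap, h, if_false, dif_neg, not_false_iff]
    rfl

theorem integral_gaussian_mul_comp_sliceProj (hp : p ≤ n) {k : (Fin n → ℝ) → ℝ}
    (hk : Measurable k) :
    ∫ u : Fin n → ℝ, Real.exp (-∑ j : Fin n, if j.val < p then u j ^ 2 else 0) *
      k (sliceProj p m u) = Real.pi ^ ((p : ℝ) / 2) * ∫ x, k x ∂deltaMeasure p m := by
  set e := MeasurableEquiv.piEquivPiSubtypeProd (fun _ : Fin n => ℝ) (fun j => j.val < p)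
  have he : MeasurePreserving e volume volume :=
    volume_preserving_piEquivPiSubtypeProd (fun _ : Fin n => ℝ) (fun j => j.val < p)
  have h1 : ∀ u : Fin n → ℝ, Real.exp (-∑ j : Fin n, if j.val < p then u j ^ 2 else 0) *
      k (sliceProj p m u) = (fun z : ({j : Fin n // j.val < p} → ℝ) ×
        ({j : Fin n // ¬j.val < p} → ℝ) =>
          (∏ j, Real.exp (-1 * z.1 j ^ 2)) * k (sliceMap p m z.2)) (e u) := by
    intro u
    rw [sliceProj_eq]
    congr 1
    rw [← Real.exp_sum, ← Finset.sum_neg_distrib,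
      ← Fintype.sum_subtype_add_sum_subtype (fun j : Fin n => j.val < p)]
    congr 1
    rw [Finset.sum_eq_zero (s := (Finset.univ : Finset {j : Fin n // ¬j.val < p})) fun j _ => by
      rw [if_neg j.2, neg_zero], add_zero]
    refine Finset.sum_congr rfl fun j _ => ?_
    rw [if_pos j.2, neg_one_mul]
    rfl
  simp only [h1]
  rw [he.integral_comp' (fun z : ({j : Fin n // j.val < p} → ℝ) ×
        ({j : Fin n // ¬j.val < p} → ℝ) =>
          (∏ j, Real.exp (-1 * z.1 j ^ 2)) * k (sliceMap p m z.2)),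
    Measure.volume_eq_prod,
    integral_prod_mul (fun a : {j : Fin n // j.val < p} → ℝ => ∏ j, Real.exp (-1 * a j ^ 2))
      fun b => k (sliceMap p m b),
    integral_fintype_prod_volume_eq_prod fun _ t => Real.exp (-1 * t ^ 2),
    ← map_sliceMap, integral_map (measurable_sliceMap p m).aemeasurable hk.aestronglyMeasurable]
  congr 1
  rw [Finset.prod_const, integral_gaussian, Finset.card_univ, Fintype.card_subtype,
    Fin.card_filter_val_lt, min_eq_right hp, div_one, Real.sqrt_eq_rpow, ← Real.rpow_natCast,
    ← Real.rpow_mul Real.pi_pos.le]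
  congr 1
  ring

variable (P : DelzantPolytope n d) {m}

/-- On the slice `l_r` is affine and does not vanish at the point `m`, so its zero set is a proper
affine subspace and hence Lebesgue null. -/
theorem ae_ell_sliceMap_ne_zero (hm : ∀ r, P.ell r (fun i => (m i : ℝ)) ≠ 0) :
    ∀ᵐ b, ∀ r, P.ell r (sliceMap p m b) ≠ 0 := by
  rw [ae_all_iff]
  intro r
  let S : AffineSubspace ℝ ({j : Fin n // ¬j.val < p} → ℝ) :=
    { carrier := {b | P.ell r (sliceMap p m b) = 0}
      smul_vsub_vadd_mem' := by
        intro c b₁ b₂ b₃ h₁ h₂ h₃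
        have : P.ell r (sliceMap p m (c • (b₁ -ᵥ b₂) +ᵥ b₃)) =
            c * (P.ell r (sliceMap p m b₁) - P.ell r (sliceMap p m b₂)) +
              P.ell r (sliceMap p m b₃) := by
          simp only [DelzantPolytope.ell, add_sub_add_right_eq_sub, ← Finset.sum_sub_distrib,
            Finset.mul_sum]
          rw [← add_assoc, ← Finset.sum_add_distrib]
          congr 1
          refine Finset.sum_congr rfl fun j _ => ?_
          by_cases h : j.val < p
          · simp [sliceMap, h]
          · simp [sliceMap, h]
            ring
        simp only [Set.mem_ofPred_eq] at h₁ h₂ h₃ ⊢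
        rw [this, h₁, h₂, h₃]
        ring }
  have hS : S ≠ ⊤ := by
    intro h
    have h1 : (fun j : {j : Fin n // ¬j.val < p} => (m j.1 : ℝ)) ∈ S :=
      h ▸ AffineSubspace.mem_top _ _ _
    have h2 : P.ell r (sliceMap p m fun j : {j : Fin n // ¬j.val < p} => (m j.1 : ℝ)) = 0 := h1
    refine hm r ?_
    rw [← h2]
    congr 1
    funext j
    simp [sliceMap]
  rw [ae_iff]
  simp only [not_not]
  exact Measure.addHaar_affineSubspace volume S hS

theorem ae_ell_sliceProj_ne_zero (hm : ∀ r, P.ell r (fun i => (m i : ℝ)) ≠ 0) :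
    ∀ᵐ u, ∀ r, P.ell r (sliceProj p m u) ≠ 0 := by
  have h1 := (volume_preserving_piEquivPiSubtypeProd (fun _ : Fin n => ℝ)
    (fun j => j.val < p)).quasiMeasurePreserving
  have h2 := Measure.quasiMeasurePreserving_snd.comp h1
  have h3 := h2.ae (ae_ell_sliceMap_ne_zero p P hm)
  filter_upwards [h3] with u hu
  rw [sliceProj_eq]
  exact hu

theorem carrier_ae_eq_interior (hm : ∀ r, P.ell r (fun i => (m i : ℝ)) ≠ 0) :
    P.carrier =ᵐ[deltaMeasure p m] interior P.carrier := by
  have h : ∀ᵐ x ∂deltaMeasure p m, ∀ r, P.ell r x ≠ 0 := by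
    rw [← map_sliceMap, ae_map_iff (measurable_sliceMap p m).aemeasurable]
    · exact ae_ell_sliceMap_ne_zero p P hm
    · simp only [Set.ofPred_forall]
      exact MeasurableSet.iInter fun r =>
        (isOpen_ne_fun (P.continuous_ell r) continuous_const).measurableSet
  filter_upwards [h] with x hx
  refine propext ⟨fun h => ?_, fun h => interior_subset h⟩
  exact P.mem_interior_carrier.2 fun r => (h r).lt_of_ne' (hx r)

end Slice

/-! ### The norms as integrals over the polytope -/

section Norm

variable {n d : ℕ} {P : DelzantPolytope n d} (p : ℕ) {m : Fin n → ℤ}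

theorem fundamentalDomain_eq :
    fundamentalDomain P = interior P.carrier ×ˢ
      Set.univ.pi fun _ : Fin n => Set.Ico 0 (2 * Real.pi) := by
  ext q
  simp [fundamentalDomain]

theorem measurableSet_fundamentalDomain : MeasurableSet (fundamentalDomain P) := by
  rw [fundamentalDomain_eq]
  exact isOpen_interior.measurableSet.prod (MeasurableSet.univ_pi fun _ => measurableSet_Ico)

theorem volume_restrict_fundamentalDomain :
    (volume : Measure (Phase n)).restrict (fundamentalDomain P) =
      (volume.restrict (interior P.carrier)).prod
        (volume.restrict (Set.univ.pi fun _ : Fin n => Set.Ico 0 (2 * Real.pi))) := by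
  rw [Measure.prod_restrict, fundamentalDomain_eq, Measure.volume_eq_prod]

theorem volume_real_angles :
    (volume : Measure (Fin n → ℝ)).real (Set.univ.pi fun _ => Set.Ico 0 (2 * Real.pi)) =
      (2 * Real.pi) ^ n := by
  rw [Measure.real, Real.volume_pi_Ico_toReal fun _ => by positivity]
  simp

theorem continuous_weightDensity_mul_sqrt (hP : P.HalfIntegral) (hm : m ∈ P.latticePoints)
    {X : Type*} [TopologicalSpace X] {a b : X → ℝ} {f : X → Fin n → ℝ} (ha : Continuous a)
    (hb : Continuous b) (hf : Continuous f) :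
    Continuous fun t => weightDensity P m (f t) *
      Real.sqrt (extMatrix P p (a t) (b t) (f t)).det := by
  have h1 : Continuous fun t => weightDensity P m (f t) :=
    (continuous_weightDensity hP hm).comp hf
  exact h1.mul (continuous_det_extMatrix P p ha hb hf).sqrt

theorem continuous_normDensity (hP : P.HalfIntegral) (hm : m ∈ P.latticePoints) (s : ℝ) :
    Continuous (normDensity P p m s) := by
  unfold normDensity
  refine Continuous.mul (Real.continuous_exp.comp (continuous_const.mul
    (continuous_finsetSum _ fun j _ => ?_)))
    (continuous_weightDensity_mul_sqrt p hP hm continuous_const continuous_const continuous_id')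
  split_ifs <;> fun_prop

theorem eqOn_pointNormSq_gcst (s : ℝ) :
    Set.EqOn (pointNormSq (gcst p s (monomialSection P p 0 m)))
      (fun q => normDensity P p m s q.1) (fundamentalDomain P) := by
  intro q hq
  have hq' : q ∈ openOrbit P := hq.1
  exact pointNormSq_gcst p hq' s

theorem integrableOn_pointNormSq_gcst (hP : P.HalfIntegral) (hm : m ∈ P.latticePoints) (s : ℝ) :
    IntegrableOn (pointNormSq (gcst p s (monomialSection P p 0 m))) (fundamentalDomain P) := by
  have h1 : IntegrableOn (normDensity P p m s) (interior P.carrier) :=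
    ((continuous_normDensity p hP hm s).continuousOn.integrableOn_compact
      P.isCompact_carrier).mono_set interior_subset
  have h2 : IsFiniteMeasure ((volume : Measure (Fin n → ℝ)).restrict
      (Set.univ.pi fun _ => Set.Ico 0 (2 * Real.pi))) := by
    refine isFiniteMeasure_restrict.2 ?_
    rw [volume_pi_pi]
    exact (ENNReal.prod_lt_top fun _ _ => by rw [Real.volume_Ico]; exact ENNReal.ofReal_lt_top).ne
  have h3 : IntegrableOn (fun q : Phase n => normDensity P p m s q.1) (fundamentalDomain P) := by
    unfold IntegrableOn
    rw [volume_restrict_fundamentalDomain]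
    exact Integrable.comp_fst (f := normDensity P p m s) h1 _
  exact (integrableOn_congr_fun (eqOn_pointNormSq_gcst p s) measurableSet_fundamentalDomain).2 h3

theorem normSq_gcst (s : ℝ) :
    normSq P (gcst p s (monomialSection P p 0 m)) =
      ∫ x in interior P.carrier, normDensity P p m s x := by
  rw [normSq, setIntegral_congr_fun measurableSet_fundamentalDomain (eqOn_pointNormSq_gcst p s),
    volume_restrict_fundamentalDomain, integral_fun_fst, measureReal_restrict_apply_univ,
    volume_real_angles, smul_eq_mul, ← mul_assoc, one_div, inv_mul_cancel₀ (by positivity), one_mul]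

/-! ### The limit -/

/-- Rescaling of the first `p` coordinates around `m`. -/
def rescale (p : ℕ) (m : Fin n → ℤ) (ε : ℝ) (u : Fin n → ℝ) : Fin n → ℝ :=
  fun j => if j.val < p then (m j : ℝ) + ε * u j else u j

theorem continuous_rescale {X : Type*} [TopologicalSpace X] {a : X → ℝ} {f : X → Fin n → ℝ}
    (ha : Continuous a) (hf : Continuous f) : Continuous fun t => rescale p m (a t) (f t) := by
  refine continuous_pi fun j => ?_
  unfold rescale
  split_ifs <;> fun_prop

theorem rescale_zero (u : Fin n → ℝ) : rescale p m 0 u = sliceProj p m u := by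
  funext j
  simp [rescale, sliceProj]

theorem integral_comp_rescale (hp : p ≤ n) {ε : ℝ} (hε : 0 < ε) {F : (Fin n → ℝ) → ℝ}
    (hF : Measurable F) : ∫ x, F x = ε ^ p * ∫ u, F (rescale p m ε u) := by
  let D : Fin n → ℝ := fun j => if j.val < p then ε else 1
  have hD : (Matrix.diagonal D).det = ε ^ p := by
    rw [Matrix.det_diagonal, prod_ite_val_lt p hp]
  have hne : (Matrix.diagonal D).det ≠ 0 := hD ▸ (pow_pos hε p).ne'
  let c : Fin n → ℝ := fun j => if j.val < p then (m j : ℝ) else 0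
  have h2 : ∀ u, rescale p m ε u = c + Matrix.toLin' (Matrix.diagonal D) u := by
    intro u
    funext j
    simp only [rescale, c, D, Pi.add_apply, Matrix.toLin'_apply, Matrix.mulVec_diagonal]
    split_ifs <;> simp
  simp only [h2]
  rw [← integral_add_left_eq_self F c]
  conv_lhs => rw [← Real.smul_map_diagonal_volume_pi hne]
  rw [integral_smul_measure, integral_map]
  · rw [hD, abs_of_pos (pow_pos hε p), ENNReal.toReal_ofReal (pow_pos hε p).le, smul_eq_mul]
  · exact (LinearMap.continuous_of_finiteDimensional _).measurable.aemeasurable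
  · exact (hF.comp (measurable_const_add c)).aestronglyMeasurable

/-- The density of the squared norm after rescaling, with `ε = s^{-1/2}`. -/
def rescaledDensity (P : DelzantPolytope n d) (p : ℕ) (m : Fin n → ℤ) (ε : ℝ)
    (u : Fin n → ℝ) : ℝ :=
  Real.exp (-∑ j : Fin n, if j.val < p then u j ^ 2 else 0) *
    (interior P.carrier).indicator (fun x =>
      weightDensity P m x * Real.sqrt (extMatrix P p (ε ^ 2) 1 x).det) (rescale p m ε u)

theorem integral_normDensity_eq (hp : p ≤ n) (hP : P.HalfIntegral) (hm : m ∈ P.latticePoints)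
    {ε : ℝ} (hε : 0 < ε) :
    ∫ x in interior P.carrier, normDensity P p m (ε ^ 2)⁻¹ x =
      ∫ u, rescaledDensity P p m ε u := by
  have hopen : MeasurableSet (interior P.carrier) := isOpen_interior.measurableSet
  rw [← integral_indicator hopen, integral_comp_rescale (m := m) p hp hε
    ((continuous_normDensity p hP hm _).measurable.indicator hopen), ← integral_const_mul]
  congr 1
  funext u
  rw [rescaledDensity]
  by_cases hu : rescale p m ε u ∈ interior P.carrier
  · rw [Set.indicator_of_mem hu, Set.indicator_of_mem hu, normDensity,
      det_extMatrix_scale P p hp (by positivity), inv_inv, Real.sqrt_mul (by positivity)]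
    -- This is the factor `s^{p/2}` that cancels the Jacobian `ε^p`.
    have h1 : Real.sqrt ((ε ^ 2)⁻¹ ^ p) = (ε ^ p)⁻¹ := by
      rw [← inv_pow, ← pow_mul, mul_comm, pow_mul, ← inv_pow, Real.sqrt_sq (by positivity)]
    have h2 : -(ε ^ 2)⁻¹ * (∑ j : Fin n,
        if j.val < p then (rescale p m ε u j - m j) ^ 2 else 0) =
          -∑ j : Fin n, if j.val < p then u j ^ 2 else 0 := by
      rw [neg_mul, Finset.mul_sum]
      congr 1
      refine Finset.sum_congr rfl fun j _ => ?_
      by_cases hj : j.val < p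
      · simp only [rescale, hj, if_true]
        field_simp
        ring
      · simp [hj]
    rw [h1, h2]
    have h3 : ε ^ p ≠ 0 := (pow_pos hε p).ne'
    field_simp
  · rw [Set.indicator_of_notMem hu, Set.indicator_of_notMem hu]
    simp

theorem exists_norm_rescaledDensity_le (hP : P.HalfIntegral) (hm : m ∈ P.latticePoints) :
    ∃ bound : (Fin n → ℝ) → ℝ, Integrable bound ∧
      ∀ ε : ℝ, 0 ≤ ε → ε ≤ 1 → ∀ u, ‖rescaledDensity P p m ε u‖ ≤ bound u := by
  -- Compactness is used in the scale as well as in `x`: the first variable stands for `ε²`, so a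
  -- single constant serves all `ε ≤ 1`.
  obtain ⟨C, hC⟩ := (isCompact_Icc.prod P.isCompact_carrier).exists_bound_of_continuousOn
    (s := Set.Icc (0 : ℝ) 1 ×ˢ P.carrier)
    (continuous_weightDensity_mul_sqrt p hP hm continuous_fst (continuous_const (y := 1))
      continuous_snd).continuousOn
  obtain ⟨R, hR⟩ := P.isCompact_carrier.isBounded.exists_norm_le
  -- The dominating function is a product: a Gaussian in the rescaled coordinates and the indicator
  -- of a bounded interval in the others, which the rescaling leaves inside the range of `P`.
  let f : Fin n → ℝ → ℝ := fun j t =>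
    if j.val < p then Real.exp (-1 * t ^ 2) else (Set.Icc (-R) R).indicator 1 t
  have hf0 : ∀ j t, 0 ≤ f j t := fun j t => by
    simp only [f]
    split_ifs
    · positivity
    · exact Set.indicator_nonneg (fun _ _ => zero_le_one) t
  refine ⟨fun u => |C| * ∏ j, f j (u j), Integrable.const_mul (Integrable.fintype_prod fun j => ?_) _,
    fun ε h0 h1 u => ?_⟩
  · by_cases hj : j.val < p
    · simp only [f, hj, if_true]
      exact integrable_exp_neg_mul_sq one_pos
    · simp only [f, hj, if_false]
      exact (integrable_indicator_iff measurableSet_Icc).2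
        (integrableOn_const (by simp))
  · rw [rescaledDensity]
    by_cases hu : rescale p m ε u ∈ interior P.carrier
    · rw [Set.indicator_of_mem hu, norm_mul, mul_comm]
      refine mul_le_mul ?_ (le_of_eq ?_) (norm_nonneg _) (abs_nonneg _)
      · exact (hC (ε ^ 2, rescale p m ε u) ⟨⟨by positivity, pow_le_one₀ h0 h1⟩,
          interior_subset hu⟩).trans (le_abs_self C)
      · rw [Real.norm_of_nonneg (Real.exp_pos _).le, ← Finset.sum_neg_distrib, Real.exp_sum]
        refine Finset.prod_congr rfl fun j _ => ?_
        by_cases hj : j.val < p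
        · simp [f, hj]
        · have h2 : |u j| ≤ R := by
            have := (norm_le_pi_norm (rescale p m ε u) j).trans (hR _ (interior_subset hu))
            simpa [rescale, hj] using this
          simp [f, hj, abs_le.1 h2]
    · rw [Set.indicator_of_notMem hu, mul_zero, norm_zero]
      exact mul_nonneg (abs_nonneg _) (Finset.prod_nonneg fun j _ => hf0 j _)

theorem measurable_rescaledDensity (hP : P.HalfIntegral) (hm : m ∈ P.latticePoints) (ε : ℝ) :
    Measurable (rescaledDensity P p m ε) := by
  unfold rescaledDensity
  refine Measurable.mul ?_ ?_
  · refine Real.measurable_exp.comp (Measurable.neg (Finset.measurable_fun_sum _ fun j _ => ?_))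
    split_ifs <;> fun_prop
  · refine Measurable.comp (Measurable.indicator ?_ isOpen_interior.measurableSet) ?_
    · exact (continuous_weightDensity_mul_sqrt p hP hm continuous_const continuous_const
        continuous_id').measurable
    · exact (continuous_rescale p continuous_const continuous_id').measurable

/-- Off the facet hyperplanes the limit point is either interior or has some `l_r < 0`. Both
conditions are open, so the indicator is eventually constant as `ε → 0`. -/
theorem tendsto_rescaledDensity (hP : P.HalfIntegral) (hm : m ∈ P.latticePoints) {u : Fin n → ℝ}
    (hu : ∀ r, P.ell r (sliceProj p m u) ≠ 0) :
    Tendsto (fun ε => rescaledDensity P p m ε u) (𝓝 0) (𝓝 (rescaledDensity P p m 0 u)) := by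
  have hc : Continuous fun ε : ℝ => rescale p m ε u :=
    continuous_rescale p continuous_id' continuous_const
  refine Tendsto.const_mul _ ?_
  rw [rescale_zero]
  by_cases h : sliceProj p m u ∈ interior P.carrier
  · have hev : ∀ᶠ ε in 𝓝 (0 : ℝ), rescale p m ε u ∈ interior P.carrier := by
      refine hc.continuousAt.eventually_mem (isOpen_interior.mem_nhds ?_)
      rwa [rescale_zero]
    rw [Set.indicator_of_mem h]
    have h2 : Continuous fun ε : ℝ => weightDensity P m (rescale p m ε u) *
        Real.sqrt (extMatrix P p (ε ^ 2) 1 (rescale p m ε u)).det :=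
      continuous_weightDensity_mul_sqrt p hP hm (continuous_pow 2) continuous_const hc
    have h3 := h2.tendsto 0
    rw [rescale_zero] at h3
    refine h3.congr' ?_
    filter_upwards [hev] with ε hε
    rw [Set.indicator_of_mem hε]
  · rw [Set.indicator_of_notMem h]
    rw [P.mem_interior_carrier] at h
    push Not at h
    obtain ⟨r, hr⟩ := h
    have hev : ∀ᶠ ε in 𝓝 (0 : ℝ), P.ell r (rescale p m ε u) < 0 := by
      refine ((P.continuous_ell r).comp hc).continuousAt.eventually_lt_const ?_
      rw [Function.comp_apply, rescale_zero]
      exact lt_of_le_of_ne hr (hu r)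
    refine tendsto_const_nhds.congr' ?_
    filter_upwards [hev] with ε hε
    rw [Set.indicator_of_notMem fun h => (P.mem_interior_carrier.1 h r).not_gt hε]

/-- In the interior the density agrees with a function continuous on the compact polytope, and the
boundary is null for the delta measure. -/
theorem integrableOn_limitDensity (hP : P.HalfIntegral) (hm : m ∈ P.latticePoints) :
    IntegrableOn (limitDensity P p m) P.carrier (deltaMeasure p m) := by
  have hne : ∀ r, P.ell r (fun i => (m i : ℝ)) ≠ 0 := fun r =>
    (lt_of_lt_of_le (by norm_num) (hP.half_le_ell hm r)).ne'
  have hc : Continuous fun x => weightDensity P m x * Real.sqrt (extMatrix P p 0 1 x).det :=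
    continuous_weightDensity_mul_sqrt p hP hm continuous_const continuous_const continuous_id'
  refine IntegrableOn.congr_set_ae ?_ (carrier_ae_eq_interior p P hne)
  exact ((hc.continuousOn.integrableOn_compact P.isCompact_carrier).mono_set
    interior_subset).congr_fun (fun x hx => (limitDensity_eq p hx).symm)
      isOpen_interior.measurableSet

theorem integral_rescaledDensity_zero (hp : p ≤ n) (hP : P.HalfIntegral)
    (hm : m ∈ P.latticePoints) :
    ∫ u, rescaledDensity P p m 0 u = limitConst P p m * Real.pi ^ ((p : ℝ) / 2) := by
  have hne : ∀ r, P.ell r (fun i => (m i : ℝ)) ≠ 0 := fun r =>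
    (lt_of_lt_of_le (by norm_num) (hP.half_le_ell hm r)).ne'
  have hopen : MeasurableSet (interior P.carrier) := isOpen_interior.measurableSet
  have hc : Continuous fun x => weightDensity P m x * Real.sqrt (extMatrix P p 0 1 x).det :=
    continuous_weightDensity_mul_sqrt p hP hm continuous_const continuous_const continuous_id'
  simp only [rescaledDensity, rescale_zero, zero_pow two_ne_zero]
  rw [integral_gaussian_mul_comp_sliceProj p m hp (hc.measurable.indicator hopen),
    integral_indicator hopen, limitConst,
    setIntegral_congr_set (carrier_ae_eq_interior p P hne),
    setIntegral_congr_fun hopen fun x hx => limitDensity_eq p hx, mul_comm]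

theorem tendsto_normSq_gcst (hp : p ≤ n) (hP : P.HalfIntegral) (hm : m ∈ P.latticePoints) :
    Tendsto (fun s : ℝ => normSq P (gcst p s (monomialSection P p 0 m))) atTop
      (𝓝 (limitConst P p m * Real.pi ^ ((p : ℝ) / 2))) := by
  have hne : ∀ r, P.ell r (fun i => (m i : ℝ)) ≠ 0 := fun r =>
    (lt_of_lt_of_le (by norm_num) (hP.half_le_ell hm r)).ne'
  obtain ⟨bound, hb, hle⟩ := exists_norm_rescaledDensity_le p hP hm
  have h0 : Tendsto (fun s : ℝ => (Real.sqrt s)⁻¹) atTop (𝓝 0) :=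
    tendsto_inv_atTop_zero.comp Real.tendsto_sqrt_atTop
  rw [← integral_rescaledDensity_zero p hp hP hm]
  have h1 : Tendsto (fun s : ℝ => ∫ u, rescaledDensity P p m (Real.sqrt s)⁻¹ u) atTop
      (𝓝 (∫ u, rescaledDensity P p m 0 u)) := by
    refine tendsto_integral_filter_of_dominated_convergence bound
      (Eventually.of_forall fun s =>
        (measurable_rescaledDensity p hP hm _).aestronglyMeasurable) ?_ hb ?_
    · filter_upwards [eventually_ge_atTop 1] with s hs
      refine Eventually.of_forall fun u => hle _ (by positivity) ?_ u
      exact inv_le_one_of_one_le₀ (Real.one_le_sqrt.2 hs)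
    · filter_upwards [ae_ell_sliceProj_ne_zero p P hne] with u hu
      exact (tendsto_rescaledDensity p hP hm hu).comp h0
  refine h1.congr' ?_
  filter_upwards [eventually_gt_atTop 0] with s hs
  rw [normSq_gcst, ← integral_normDensity_eq p hp hP hm (inv_pos.2 (Real.sqrt_pos.2 hs)), inv_pow,
    inv_inv, Real.sq_sqrt hs.le]

end Norm

/-! ### The transformed sections as a basis of the quantum space -/

section Basis

variable {n d : ℕ} (P : DelzantPolytope n d) (p : ℕ) (s : ℝ)

/-- The eigenvalue of `e^{-s H^Q}` on the monomial section of weight `m`, as a unit. -/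
def heatUnit (m : Fin n → ℤ) : ℂˣ :=
  Units.mk0 (Complex.exp (-(s : ℂ) * ((ham p (fun i => (m i : ℝ)) : ℝ) : ℂ)))
    (Complex.exp_ne_zero _)

theorem gcst_monomialSection_coeff_eq_units_smul :
    (fun m : P.latticePoints => (gcst p s (monomialSection P p 0 m.1)).coeff) =
      (fun m : P.latticePoints => heatUnit p s m.1) •
        fun m : P.latticePoints => (monomialSection P p s m.1).coeff := by
  funext m
  exact gcst_monomialSection_coeff

theorem linearIndependent_gcst_monomialSection :
    LinearIndependent ℂ fun m : P.latticePoints =>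
      (gcst p s (monomialSection P p 0 m.1)).coeff := by
  rw [gcst_monomialSection_coeff_eq_units_smul]
  exact (linearIndependent_monomialSection P p s).units_smul _

theorem span_gcst_monomialSection :
    Submodule.span ℂ (Set.range fun m : P.latticePoints =>
      (gcst p s (monomialSection P p 0 m.1)).coeff) = quantumSpace P p s := by
  rw [gcst_monomialSection_coeff_eq_units_smul, quantumSpace]
  refine le_antisymm (Submodule.span_le.2 ?_) (Submodule.span_le.2 ?_)
  · rintro _ ⟨m, rfl⟩
    exact Submodule.smul_mem _ (heatUnit p s m.1 : ℂ) (Submodule.subset_span ⟨m, rfl⟩)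
  · rintro _ ⟨m, rfl⟩
    have h : (monomialSection P p s m.1).coeff = (((heatUnit p s m.1)⁻¹ : ℂˣ) : ℂ) •
        (heatUnit p s m.1 • (monomialSection P p s m.1).coeff) := by
      rw [← Units.smul_def, inv_smul_smul]
    refine (congrArg (· ∈ _) h).mpr ?_
    exact Submodule.smul_mem _ _ (Submodule.subset_span ⟨m, rfl⟩)

end Basis

end ToricMixed

end

theorem theorem4p8 {n d : ℕ} (p : ℕ) (hp : p < n)
    (P : ToricMixed.DelzantPolytope n d) (hP : P.HalfIntegral) :
    -- `H^Q` acts by `H^Q σ^m_s = H(m) σ^m_s`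
    (∀ s : ℝ, 0 ≤ s → ∀ m ∈ P.latticePoints,
      ToricMixed.quantumHam p (ToricMixed.monomialSection P p s m).coeff =
        ((ToricMixed.ham p (fun i => (m i : ℝ)) : ℝ) : ℂ) •
          (ToricMixed.monomialSection P p s m).coeff) ∧
    -- the sections `U_s σ^m_0` form a basis of the quantum space at time `s`
    (∀ s : ℝ, 0 ≤ s →
      (∀ m ∈ P.latticePoints,
        (ToricMixed.gcst p s (ToricMixed.monomialSection P p 0 m)).form =
          ToricMixed.dZ P p s) ∧
      LinearIndependent ℂ (fun m : P.latticePoints =>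
        (ToricMixed.gcst p s (ToricMixed.monomialSection P p 0 m.1)).coeff) ∧
      Submodule.span ℂ (Set.range fun m : P.latticePoints =>
        (ToricMixed.gcst p s (ToricMixed.monomialSection P p 0 m.1)).coeff) =
          ToricMixed.quantumSpace P p s) ∧
    -- the `L²` norms and the constant `c_m` are given by convergent integrals, and the limit
    ∀ m ∈ P.latticePoints,
      (∀ s : ℝ, 0 ≤ s → MeasureTheory.IntegrableOn
        (ToricMixed.pointNormSq (ToricMixed.gcst p s (ToricMixed.monomialSection P p 0 m)))
        (ToricMixed.fundamentalDomain P)) ∧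
      MeasureTheory.IntegrableOn (ToricMixed.limitDensity P p m) P.carrier
        (ToricMixed.deltaMeasure p m) ∧
      Filter.Tendsto
        (fun s : ℝ => ToricMixed.normSq P
          (ToricMixed.gcst p s (ToricMixed.monomialSection P p 0 m)))
        Filter.atTop
        (nhds (ToricMixed.limitConst P p m * Real.pi ^ ((p : ℝ) / 2))) := by
  refine ⟨fun s _ m _ => ToricMixed.quantumHam_monomialSection P p s m,
    fun s _ => ⟨fun m _ => ToricMixed.gcst_monomialSection_form P p s m,
      ToricMixed.linearIndependent_gcst_monomialSection P p s,
      ToricMixed.span_gcst_monomialSection P p s⟩,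
    fun m hm => ⟨fun s _ => ToricMixed.integrableOn_pointNormSq_gcst p hP hm s,
      ToricMixed.integrableOn_limitDensity p hP hm,
      ToricMixed.tendsto_normSq_gcst p hp.le hP hm⟩⟩
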